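/- Let $d\ge 2$. A QCSP $\mathcal C$ on $d$-qudits is a finite list of clause types $\mathcal H_1,\dots,\mathcal H_t$, where $\mathcal H_i$ is a Hermitian projector on $(\mathbb C^d)^{\otimes m_i}$; it is $k$-local if every arity $m_i$ is at most $k$. An instance consists of a number $n$ of qudits and a finite list of clauses, each being a clause type applied to an ordered tuple of distinct qudits and extended by the identity to an operator $H_j$ on $(\mathbb C^d)^{\otimes n}$. It is satisfiable if there is $\psi\neq 0$ with $H_j\psi=0$ for all $j$; its ground state energy is the least eigenvalue of $\sum_j H_j$. An instance is written as a bit string listing $n$ and, for each clause, the number of its type and the numbers of its qudits (padded with zeros to the maximal arity), all as binary integers of a common width; the width and the number of clauses are given in unary in front, and zeros may follow at the end. An $\mathsf{AC}^0$ function on bit strings is one computed by a family of Boolean circuits (one for each input length) with NOT gates and unbounded fan-in AND and OR gates, of constant depth and polynomial size. A function $f$ on bit strings reduces a QCSP $\mathcal C$ to a QCSP $\mathcal C'$ if it maps encodings of satisfiable (respectively unsatisfiable) instances of $\mathcal C$ to encodings of satisfiable (respectively unsatisfiable) instances of $\mathcal C'$, and if for every function $b$ bounded below by an inverse polynomial there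 is such a function $b'$ for which $f$ maps encodings of instances of $\mathcal C$ on $n$ qudits with ground state energy at least $b(n)$ to encodings of instances of $\mathcal C'$ on some number $n'$ of qudits with ground state energy at least $b'(n')$. **Theorem.** For every QCSP $\mathcal C$ on $d$-qudits there are a QCSP $\mathcal C'$ on qubits and $\mathsf{AC}^0$ functions $f$ and $g$ such that $f$ reduces $\mathcal C$ to $\mathcal C'$ and $g$ reduces $\mathcal C'$ to $\mathcal C$. Moreover $\mathcal C'$ can be chosen such that, whenever $\mathcal C$ is $k$-local, $\mathcal C'$ is $4\cdot 2^{\lceil\log_2\lceil\log_2 d\rceil\rceil}k$-local. -/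

import Mathlib

/-- A quantum constraint satisfaction problem on `d`-qudits: finitely many clause types, the `i`-th
one being an orthogonal projector on `(ℂ^d)^{⊗ arity i}`, written as a matrix in the computational
basis, whose elements are the functions `Fin (arity i) → Fin d`. -/
structure QCSP (d : ℕ) where
  numTypes : ℕ
  arity : Fin numTypes → ℕ
  clause : ∀ i, Matrix (Fin (arity i) → Fin d) (Fin (arity i) → Fin d) ℂ
  clause_hermitian : ∀ i, (clause i).IsHermitian
  clause_idempotent : ∀ i, clause i * clause i = clause i

/-- The operator on `n` qudits that acts as `H` on the qudits `e 0, e 1, …` (in this order) and as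
the identity on the other qudits. -/
def extendOp {d m n : ℕ} (H : Matrix (Fin m → Fin d) (Fin m → Fin d) ℂ) (e : Fin m ↪ Fin n) :
    Matrix (Fin n → Fin d) (Fin n → Fin d) ℂ :=
  fun a b => if ∀ j, (∀ i, e i ≠ j) → a j = b j then H (a ∘ e) (b ∘ e) else 0

namespace QCSP

variable {d : ℕ}

/-- All clause types have arity at most `k`. -/
def IsLocal (C : QCSP d) (k : ℕ) : Prop := ∀ i, C.arity i ≤ k

/-- The largest arity of a clause type (`0` if there is no clause type). -/
def maxArity (C : QCSP d) : ℕ := Finset.univ.sup C.arity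

/-- A clause type applied to an ordered tuple of distinct qudits among `n`. -/
structure Placed (C : QCSP d) (n : ℕ) where
  type : Fin C.numTypes
  args : Fin (C.arity type) ↪ Fin n

/-- The operator of a placed clause on the whole space `(ℂ^d)^{⊗ n}`. -/
def Placed.op {C : QCSP d} {n : ℕ} (c : C.Placed n) :
    Matrix (Fin n → Fin d) (Fin n → Fin d) ℂ :=
  extendOp (C.clause c.type) c.args

/-- An instance: a number `n` of qudits and a list of clauses applied to them. -/
structure Instance (C : QCSP d) where
  n : ℕ
  clauses : List (C.Placed n)

namespace Instance

variable {C : QCSP d}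

/-- Some nonzero state is annihilated by every clause. -/
def Satisfiable (I : C.Instance) : Prop :=
  ∃ ψ : (Fin I.n → Fin d) → ℂ, ψ ≠ 0 ∧ ∀ c ∈ I.clauses, c.op.mulVec ψ = 0

/-- The total Hamiltonian, the sum of all clauses of the instance. -/
def hamiltonian (I : C.Instance) : Matrix (Fin I.n → Fin d) (Fin I.n → Fin d) ℂ :=
  (I.clauses.map Placed.op).sum

/-- The ground state energy is at least `b`: `⟨ψ|H|ψ⟩ ≥ b ⟨ψ|ψ⟩` for every vector `ψ`. -/
def EnergyAtLeast (I : C.Instance) (b : ℝ) : Prop :=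
  ∀ ψ : (Fin I.n → Fin d) → ℂ,
    b * (dotProduct (star ψ) ψ).re ≤ (dotProduct (star ψ) (I.hamiltonian.mulVec ψ)).re

end Instance

/-- A placed clause as a list of `1 + maxArity` integers: the clause type, then the qudits it acts
on, then zeros, so that all the clauses of an instance take the same number of integers. -/
def Placed.ints {C : QCSP d} {n : ℕ} (c : C.Placed n) : List ℕ :=
  (c.type : ℕ) ::
    (List.ofFn (fun j => (c.args j : ℕ)) ++ List.replicate (C.maxArity - C.arity c.type) 0)

/-- An instance as a list of integers: the number of qudits, then the clauses one after another. -/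
def Instance.ints {C : QCSP d} (I : C.Instance) : List ℕ :=
  I.n :: I.clauses.flatMap Placed.ints

/-- The `w` lowest binary digits of `a`, the least significant one first. -/
def bits (w a : ℕ) : List Bool := List.ofFn fun i : Fin w => a.testBit i

/-- The bit string `s` is an encoding of the instance `I`: for some width `w` that is large enough
for all integers of `I`, it consists of `w` and the number of clauses, both in unary and closed by a
`0`, of the integers of `I`, each with `w` binary digits, and of any number of zeros. (A circuit has
a fixed output length, hence the freedom to pad.) -/
def Instance.Encodes {C : QCSP d} (s : List Bool) (I : C.Instance) : Prop :=
  ∃ w pad : ℕ, (∀ a ∈ I.ints, a < 2 ^ w) ∧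
    s = List.replicate w true ++ [false] ++ List.replicate I.clauses.length true ++ [false] ++
      I.ints.flatMap (bits w) ++ List.replicate pad false

end QCSP

/-- A promise problem on bit strings. -/
structure PromiseProblem where
  yes : Set (List Bool)
  no : Set (List Bool)

/-- `f` is a many-one reduction from `A` to `B`. -/
def PromiseProblem.ReducesVia (A B : PromiseProblem) (f : List Bool → List Bool) : Prop :=
  (∀ s ∈ A.yes, f s ∈ B.yes) ∧ (∀ s ∈ A.no, f s ∈ B.no)

/-- A function `b` of the number of qudits that is bounded below by an inverse polynomial. -/
def InversePolyBounded (b : ℕ → ℝ) : Prop :=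
  ∃ p : Polynomial ℕ, ∀ n : ℕ, 1 / (((p.eval n : ℕ) : ℝ) + 1) ≤ b n

namespace QCSP

variable {d : ℕ}

/-- Decide whether a given instance is satisfiable. -/
def exactProblem (C : QCSP d) : PromiseProblem where
  yes := {s | ∃ I : C.Instance, I.Encodes s ∧ I.Satisfiable}
  no := {s | ∃ I : C.Instance, I.Encodes s ∧ ¬ I.Satisfiable}

/-- Decide whether a given instance is satisfiable, under the promise that otherwise its ground
state energy is at least `b n`, where `n` is its number of qudits. -/
def gapProblem (C : QCSP d) (b : ℕ → ℝ) : PromiseProblem where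
  yes := {s | ∃ I : C.Instance, I.Encodes s ∧ I.Satisfiable}
  no := {s | ∃ I : C.Instance, I.Encodes s ∧ I.EnergyAtLeast (b I.n)}

/-- `f` reduces `C` to `C'`, both as the problem of exact satisfiability and as the promise problem
with an inverse polynomial gap: `f` turns every such promise on `C` into such a promise on `C'`. -/
def ReducesVia {d' : ℕ} (C : QCSP d) (C' : QCSP d') (f : List Bool → List Bool) : Prop :=
  C.exactProblem.ReducesVia C'.exactProblem f ∧
  ∀ b, InversePolyBounded b →
    ∃ b', InversePolyBounded b' ∧ (C.gapProblem b).ReducesVia (C'.gapProblem b') f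

end QCSP

/-- Boolean circuits on `N` input bits with negations and with conjunctions and disjunctions of
unbounded fan-in (fan-in `0` gives the constants). They are trees: a circuit of constant depth and
polynomial size unfolds to a tree of the same depth and of polynomial size, so the functions of
constant depth and polynomial size are the same. -/
inductive BoolCircuit (N : ℕ) : Type
  | input (i : Fin N) : BoolCircuit N
  | not (c : BoolCircuit N) : BoolCircuit N
  | and (m : ℕ) (c : Fin m → BoolCircuit N) : BoolCircuit N
  | or (m : ℕ) (c : Fin m → BoolCircuit N) : BoolCircuit N

namespace BoolCircuit

variable {N : ℕ}

/-- The output bit on the input `x`. -/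
def eval (x : Fin N → Bool) : BoolCircuit N → Bool
  | input i => x i
  | not c => !(eval x c)
  | and _ c => decide (∀ i, eval x (c i) = true)
  | or _ c => decide (∃ i, eval x (c i) = true)

/-- The number of gates and input leaves. -/
def size : BoolCircuit N → ℕ
  | input _ => 1
  | not c => size c + 1
  | and _ c => ∑ i, size (c i) + 1
  | or _ c => ∑ i, size (c i) + 1

/-- The largest number of gates on a path from an input to the output. -/
def depth : BoolCircuit N → ℕ
  | input _ => 0
  | not c => depth c + 1
  | and _ c => Finset.univ.sup (fun i => depth (c i)) + 1
  | or _ c => Finset.univ.sup (fun i => depth (c i)) + 1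

end BoolCircuit

/-- `f` is computed by an `AC⁰` circuit family: for every input length `N` there are circuits, one
for each of the `ℓ N` output bits, of depth bounded by a constant and of total size bounded by a
polynomial in `N`. -/
def IsAC0 (f : List Bool → List Bool) : Prop :=
  ∃ (ℓ : ℕ → ℕ) (F : ∀ N, Fin (ℓ N) → BoolCircuit N) (D : ℕ) (p : Polynomial ℕ),
    (∀ N j, (F N j).depth ≤ D) ∧
    (∀ N, ∑ j, (F N j).size ≤ p.eval N) ∧
    ∀ s : List Bool, f s = List.ofFn fun j => (F s.length j).eval s.get

/-! Each qudit is encoded into r = 4·2^⌈log₂⌈log₂ d⌉⌉ qubits by an isometry V, and a clause h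
becomes the projector 1 − V^⊗(1 − h)(V^⊗)ᴴ, which penalises leaving the code space as well as
violating h. Resolving every site into the code space and its complement shows that energy at least
b becomes energy at least min(b, 1): in each sector either all clauses act on code states, or one of
them contributes the full squared norm (`BoundedBelow.of_resolution`, `BoundedBelow.encode`).
Conversely V^⊗ is an isometry that intertwines the two Hamiltonians (`BoundedBelow.decode`). In
finite dimension an instance is unsatisfiable iff its energy has a positive lower bound, so exact
satisfiability follows from the energy bounds.

The difficulty is the reduction back: an instance on qubits may apply clauses to blocks that overlap
partially or are permuted. Therefore the code space is taken inside the kernel of generic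
functionals B, such that no nonzero state is annihilated by B on two blocks that overlap but differ
as ordered tuples (`exists_separating`). Only finitely many overlap patterns matter, and each
excludes a proper Zariski closed set of B, so one good B per pattern suffices. If a shared qubit
sits at two different positions, B can demand the value 0 at one and 1 at the other; otherwise B can
demand singlets, which a qubit cannot form with two partners. Both use at most 2^r − 2^(r−2)
functionals, which leaves room for d ≤ 2^(r−2) dimensions.

Hence an instance with conflicting blocks is unsatisfiable and is sent to a fixed unsatisfiable
instance of C; no estimate of its energy is needed. Without conflicts the blocks are disjoint and
act as qudits. If C has no unsatisfiable instance, a QCSP without clause types serves as C'.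

Both maps are in AC⁰. Circuits are nonuniform, so arithmetic on positions is free; r is a power of
two, so passing from a qudit to its qubits shifts digits; in the other direction a qudit is numbered
by the first qubit of its block, so integers are only copied. -/

open Matrix

/-! ### Closure properties of relations computed in constant depth -/

/-- The relation `φ a s` between a parameter `a` and a bit string `s` is computed by circuits of
constant depth and polynomial size, uniformly in the parameter. -/
def AC0Rel {α : Type*} (φ : α → List Bool → Prop) : Prop :=
  ∃ D k : ℕ, ∀ N a, ∃ c : BoolCircuit N, c.depth ≤ D ∧ c.size ≤ (N + 2) ^ k ∧
    ∀ x : Fin N → Bool, c.eval x = true ↔ φ a (List.ofFn x)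

namespace AC0Rel

variable {α : Type*} {φ ψ : α → List Bool → Prop}

theorem congr (h : AC0Rel φ) (e : ∀ a s, ψ a s ↔ φ a s) : AC0Rel ψ := by
  obtain ⟨D, k, h⟩ := h
  refine ⟨D, k, fun N a => ?_⟩
  obtain ⟨c, h1, h2, h3⟩ := h N a
  exact ⟨c, h1, h2, fun x => (h3 x).trans (e _ _).symm⟩

/-- The circuit may be chosen separately for each parameter and length, so any condition on these,
however complex, costs one constant gate. All arithmetic on positions is absorbed in this way. -/
theorem ofLength (p : α → ℕ → Prop) : AC0Rel fun a s => p a s.length := by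
  classical
  refine ⟨1, 0, fun N a => ?_⟩
  by_cases h : p a N
  · exact ⟨.and 0 Fin.elim0, by simp [BoolCircuit.depth], by simp [BoolCircuit.size],
      fun x => by simp [BoolCircuit.eval, h]⟩
  · exact ⟨.or 0 Fin.elim0, by simp [BoolCircuit.depth], by simp [BoolCircuit.size],
      fun x => by simp [BoolCircuit.eval, h]⟩

theorem const (p : α → Prop) : AC0Rel fun a (_ : List Bool) => p a := ofLength fun a _ => p a

theorem bit (i : α → ℕ) : AC0Rel fun a s => s.getD (i a) false = true := by
  refine ⟨1, 0, fun N a => ?_⟩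
  by_cases h : i a < N
  · exact ⟨.input ⟨i a, h⟩, by simp [BoolCircuit.depth], by simp [BoolCircuit.size],
      fun x => by simp [BoolCircuit.eval, List.getD, h]⟩
  · exact ⟨.or 0 Fin.elim0, by simp [BoolCircuit.depth], by simp [BoolCircuit.size],
      fun x => by simp [BoolCircuit.eval, List.getD, h]⟩

theorem not (h : AC0Rel φ) : AC0Rel fun a s => ¬ φ a s := by
  obtain ⟨D, k, h⟩ := h
  refine ⟨D + 1, k + 1, fun N a => ?_⟩
  obtain ⟨c, h1, h2, h3⟩ := h N a
  refine ⟨.not c, by simpa [BoolCircuit.depth] using h1, ?_, fun x => ?_⟩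
  · have : 1 ≤ (N + 2) ^ k := Nat.one_le_pow _ _ (by omega)
    simp only [BoolCircuit.size, pow_succ]
    nlinarith
  · simp [BoolCircuit.eval, ← h3 x]

/-- Bounded existential quantifiers are disjunctions of polynomial fan-in. -/
theorem exists_lt {φ : α × ℕ → List Bool → Prop} (h : AC0Rel φ) (B : α → ℕ → ℕ) (e : ℕ)
    (hB : ∀ a N, B a N ≤ (N + 2) ^ e) :
    AC0Rel fun a s => ∃ i < B a s.length, φ (a, i) s := by
  obtain ⟨D, k, h⟩ := h
  refine ⟨D + 1, e + k + 1, fun N a => ?_⟩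
  choose c h1 h2 h3 using fun i => h N (a, i)
  refine ⟨.or (B a N) fun i => c i, ?_, ?_, fun x => ?_⟩
  · simp only [BoolCircuit.depth, add_le_add_iff_right]
    exact Finset.sup_le fun i _ => h1 i
  · have h4 : ∑ i : Fin (B a N), (c i).size ≤ B a N * (N + 2) ^ k := by
      calc _ ≤ ∑ i : Fin (B a N), (N + 2) ^ k := Finset.sum_le_sum fun i _ => h2 i
        _ = _ := by simp
    have h5 : B a N * (N + 2) ^ k ≤ (N + 2) ^ e * (N + 2) ^ k := Nat.mul_le_mul_right _ (hB a N)
    have h6 : 1 ≤ (N + 2) ^ (e + k) := Nat.one_le_pow _ _ (by omega)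
    simp only [BoolCircuit.size, pow_succ]
    rw [← pow_add] at h5
    nlinarith
  · simp only [BoolCircuit.eval, decide_eq_true_eq, h3, List.length_ofFn]
    exact ⟨fun ⟨i, hi⟩ => ⟨i, i.2, hi⟩, fun ⟨i, hi, hi'⟩ => ⟨⟨i, hi⟩, hi'⟩⟩

theorem forall_lt {φ : α × ℕ → List Bool → Prop} (h : AC0Rel φ) (B : α → ℕ → ℕ) (e : ℕ)
    (hB : ∀ a N, B a N ≤ (N + 2) ^ e) :
    AC0Rel fun a s => ∀ i < B a s.length, φ (a, i) s :=
  (h.not.exists_lt B e hB).not.congr fun a s => by push Not; rfl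

theorem and (h : AC0Rel φ) (h' : AC0Rel ψ) : AC0Rel fun a s => φ a s ∧ ψ a s := by
  obtain ⟨D, k, h⟩ := h
  obtain ⟨D', k', h'⟩ := h'
  -- A conjunction is a universal quantifier over two values, the extra parameter selecting the
  -- formula; the size estimate of `forall_lt` is thus reused.
  have key : AC0Rel fun (p : α × ℕ) s => if p.2 = 0 then φ p.1 s else ψ p.1 s := by
    refine ⟨max D D', max k k', fun N p => ?_⟩
    by_cases hp : p.2 = 0
    · obtain ⟨c, h1, h2, h3⟩ := h N p.1
      exact ⟨c, h1.trans (le_max_left _ _),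
        h2.trans (Nat.pow_le_pow_right (by omega) (le_max_left _ _)), by simpa [hp] using h3⟩
    · obtain ⟨c, h1, h2, h3⟩ := h' N p.1
      exact ⟨c, h1.trans (le_max_right _ _),
        h2.trans (Nat.pow_le_pow_right (by omega) (le_max_right _ _)), by simpa [hp] using h3⟩
  refine (key.forall_lt (fun _ _ => 2) 1 (fun _ N => by simp)).congr fun a s => ?_
  constructor
  · rintro ⟨h1, h2⟩ i _
    by_cases hi : i = 0 <;> simp [hi, h1, h2]
  · intro h
    exact ⟨by simpa using h 0 (by omega), by simpa using h 1 (by omega)⟩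

theorem or (h : AC0Rel φ) (h' : AC0Rel ψ) : AC0Rel fun a s => φ a s ∨ ψ a s :=
  (h.not.and h'.not).not.congr fun a s => by tauto

theorem imp (h : AC0Rel φ) (h' : AC0Rel ψ) : AC0Rel fun a s => φ a s → ψ a s :=
  (h.not.or h').congr fun a s => by tauto

theorem iff (h : AC0Rel φ) (h' : AC0Rel ψ) : AC0Rel fun a s => (φ a s ↔ ψ a s) :=
  ((h.imp h').and (h'.imp h)).congr fun a s => by tauto

open Classical in
/-- A function whose output bits are given by a single relation is in `AC⁰`. -/
theorem isAC0 {φ : ℕ → List Bool → Prop} (h : AC0Rel φ) (ℓ : Polynomial ℕ) :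
    IsAC0 fun s => List.ofFn fun j : Fin (ℓ.eval s.length) => decide (φ j s) := by
  obtain ⟨D, k, h⟩ := h
  choose c h1 h2 h3 using h
  refine ⟨fun N => ℓ.eval N, fun N j => c N j, D, ℓ * (Polynomial.X + 2) ^ k, fun N j => h1 N j,
    fun N => ?_, fun s => ?_⟩
  · calc _ ≤ ∑ j : Fin (ℓ.eval N), (N + 2) ^ k := Finset.sum_le_sum fun j _ => h2 N j
      _ = _ := by simp
  · refine congrArg List.ofFn (funext fun j => ?_)
    rw [Bool.eq_iff_iff, h3, decide_eq_true_eq, List.ofFn_get]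

end AC0Rel

/-! ### Tensor products of matrices and operators acting on some of the sites -/

section Tensor

variable {ι J X Y Z : Type*}

/-- The tensor product of the matrices `t j`, acting on functions on the sites `J`. -/
def tensorMat [Fintype J] (t : J → Matrix Y X ℂ) : Matrix (J → Y) (J → X) ℂ :=
  fun a b => ∏ j, t j (a j) (b j)

/-- The configurations `a` and `b` agree on the sites outside the range of `e`. -/
def AgreeOff (e : ι ↪ J) (a b : J → X) : Prop := ∀ j, (∀ i, e i ≠ j) → a j = b j

theorem AgreeOff.symm {e : ι ↪ J} {a b : J → X} (h : AgreeOff e a b) : AgreeOff e b a :=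
  fun j hj => (h j hj).symm

theorem agreeOff_comm {e : ι ↪ J} {a b : J → X} : AgreeOff e a b ↔ AgreeOff e b a :=
  ⟨AgreeOff.symm, AgreeOff.symm⟩

theorem extend_of_off {e : ι ↪ J} {j : J} (hj : ∀ i, e i ≠ j) (w : ι → X) (b : J → X) :
    Function.extend e w b j = b j :=
  Function.extend_apply' _ _ _ (by simpa using hj)

theorem extend_comp_embedding (e : ι ↪ J) (w : ι → X) (b : J → X) :
    Function.extend e w b ∘ e = w :=
  Function.extend_comp e.injective _ _

theorem AgreeOff.extend_eq {e : ι ↪ J} {a b : J → X} (h : AgreeOff e a b) :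
    Function.extend e (a ∘ e) b = a := by
  ext j
  by_cases hj : ∃ i, e i = j
  · obtain ⟨i, rfl⟩ := hj
    rw [e.injective.extend_apply]; rfl
  · have hj : ∀ i, e i ≠ j := by simpa using hj
    rw [extend_of_off hj, h j hj]

open Classical in
/-- The operator that acts as `H` on the sites `e i` and as the identity on the other sites. -/
noncomputable def localOp (H : Matrix (ι → X) (ι → X) ℂ) (e : ι ↪ J) :
    Matrix (J → X) (J → X) ℂ :=
  fun a b => if AgreeOff e a b then H (a ∘ e) (b ∘ e) else 0

theorem extendOp_eq_localOp {d m n : ℕ} (H : Matrix (Fin m → Fin d) (Fin m → Fin d) ℂ)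
    (e : Fin m ↪ Fin n) : extendOp H e = localOp H e := by
  ext a b
  simp only [extendOp, localOp, AgreeOff]
  congr

theorem localOp_isHermitian {H : Matrix (ι → X) (ι → X) ℂ} (h : H.IsHermitian) (e : ι ↪ J) :
    (localOp H e).IsHermitian := by
  ext a b
  simp only [localOp, Matrix.conjTranspose_apply, apply_ite star, star_zero, h.apply]
  classical exact if_congr agreeOff_comm rfl rfl

variable [Fintype J]

theorem tensorMat_mul [DecidableEq J] [Fintype X] (t : J → Matrix Z X ℂ) (u : J → Matrix X Y ℂ) :
    tensorMat t * tensorMat u = tensorMat fun j => t j * u j := by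
  ext a b
  simp only [tensorMat, Matrix.mul_apply, ← Finset.prod_mul_distrib, Finset.prod_univ_sum,
    Fintype.piFinset_univ]

theorem tensorMat_one [DecidableEq X] : tensorMat (fun _ : J => (1 : Matrix X X ℂ)) = 1 := by
  ext a b
  simp only [tensorMat, Matrix.one_apply, Finset.prod_ite_zero, Finset.prod_const_one, funext_iff,
    Finset.mem_univ, true_implies]

theorem tensorMat_conjTranspose (t : J → Matrix Y X ℂ) :
    (tensorMat t)ᴴ = tensorMat fun j => (t j)ᴴ := by
  ext a b
  simp [tensorMat, Matrix.conjTranspose_apply]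

theorem tensorMat_eq_zero {t : J → Matrix Y X ℂ} {j : J} (h : t j = 0) : tensorMat t = 0 := by
  ext a b
  exact Finset.prod_eq_zero (Finset.mem_univ j) (by simp [h])

/-- By distributivity, a resolution of the identity on one site gives one on all sites, indexed by
an outcome for each site. -/
theorem sum_tensorMat_conjTranspose_mul [DecidableEq J] [Fintype Y] {O : Type*} [Fintype O]
    (t : O → Matrix Y X ℂ) :
    ∑ τ : J → O, (tensorMat fun j => t (τ j))ᴴ * (tensorMat fun j => t (τ j)) =
      tensorMat fun _ => ∑ o, (t o)ᴴ * t o := by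
  ext a b
  simp only [tensorMat_conjTranspose, tensorMat_mul]
  simp only [tensorMat, Matrix.sum_apply, Finset.prod_univ_sum, Fintype.piFinset_univ]

-- Configurations that agree with b off the chosen sites are parametrised by their values on these
-- sites. This turns matrix products with a local operator into sums over the chosen sites alone.
open Classical in
theorem sum_agree [DecidableEq J] [Fintype X] [Fintype ι] [DecidableEq ι] (e : ι ↪ J) (b : J → X)
    (F : (J → X) → ℂ) :
    (∑ z, if AgreeOff e z b then F z else 0) = ∑ w : ι → X, F (Function.extend e w b) := by
  rw [← Finset.sum_filter]
  symm
  refine Finset.sum_bij (fun w _ => Function.extend e w b) ?_ ?_ ?_ (fun _ _ => rfl)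
  · intro w _
    simp only [Finset.mem_filter, Finset.mem_univ, true_and]
    exact fun j hj => extend_of_off hj _ _
  · intro w _ w' _ h
    ext i
    simpa [e.injective.extend_apply] using congrFun h (e i)
  · intro z hz
    simp only [Finset.mem_filter, Finset.mem_univ, true_and] at hz
    exact ⟨z ∘ e, Finset.mem_univ _, hz.extend_eq⟩

theorem prod_split [Fintype ι] (e : ι ↪ J) [DecidablePred fun j => ∀ i, e i ≠ j] (f : J → ℂ) :
    ∏ j, f j = (∏ i, f (e i)) * ∏ j with ∀ i, e i ≠ j, f j := by
  rw [← Finset.prod_filter_mul_prod_filter_not Finset.univ (fun j => ∀ i, e i ≠ j), mul_comm]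
  congr 1
  symm
  refine Finset.prod_bij (fun i _ => e i) (by simp) (by simp) ?_ (by simp)
  intro j hj
  simpa using hj

/-- Intertwining on the sites of a local operator extends to all the sites. -/
theorem tensorMat_mul_localOp [DecidableEq J] [Fintype ι] [DecidableEq ι] [Fintype X] [Fintype Y]
    (t : J → Matrix Y X ℂ) (e : ι ↪ J)
    {H : Matrix (ι → Y) (ι → Y) ℂ} {H' : Matrix (ι → X) (ι → X) ℂ}
    (h : (tensorMat fun i => t (e i)) * H' = H * tensorMat fun i => t (e i)) :
    tensorMat t * localOp H' e = localOp H e * tensorMat t := by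
  classical
  ext a b
  -- Both products have entries that factor into an entry on the chosen sites and the same product
  -- of entries of t over the other sites.
  have hL : (tensorMat t * localOp H' e) a b =
      ((tensorMat fun i => t (e i)) * H') (a ∘ e) (b ∘ e) *
        ∏ j with ∀ i, e i ≠ j, t j (a j) (b j) := by
    rw [Matrix.mul_apply]
    simp only [localOp, mul_ite, mul_zero]
    rw [sum_agree e b (fun z => tensorMat t a z * H' (z ∘ e) (b ∘ e)), Matrix.mul_apply,
      Finset.sum_mul]
    refine Finset.sum_congr rfl fun w _ => ?_
    rw [extend_comp_embedding, tensorMat, prod_split e]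
    have : ∏ j with ∀ i, e i ≠ j, t j (a j) (Function.extend e w b j) =
        ∏ j with ∀ i, e i ≠ j, t j (a j) (b j) := by
      refine Finset.prod_congr rfl fun j hj => ?_
      rw [extend_of_off (by simpa using hj)]
    rw [this]
    simp only [e.injective.extend_apply, tensorMat, Function.comp]
    ring
  have hR : (localOp H e * tensorMat t) a b =
      (H * tensorMat fun i => t (e i)) (a ∘ e) (b ∘ e) *
        ∏ j with ∀ i, e i ≠ j, t j (a j) (b j) := by
    rw [Matrix.mul_apply]
    simp only [localOp, ite_mul, zero_mul, agreeOff_comm (a := a)]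
    rw [sum_agree e a (fun z => H (a ∘ e) (z ∘ e) * tensorMat t z b), Matrix.mul_apply,
      Finset.sum_mul]
    refine Finset.sum_congr rfl fun w _ => ?_
    rw [extend_comp_embedding, tensorMat, prod_split e]
    have : ∏ j with ∀ i, e i ≠ j, t j (Function.extend e w a j) (b j) =
        ∏ j with ∀ i, e i ≠ j, t j (a j) (b j) := by
      refine Finset.prod_congr rfl fun j hj => ?_
      rw [extend_of_off (by simpa using hj)]
    rw [this]
    simp only [e.injective.extend_apply, tensorMat, Function.comp]
    ring
  rw [hL, hR, h]

theorem localOp_one [Fintype ι] [DecidableEq X] (e : ι ↪ J) :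
    localOp (1 : Matrix (ι → X) (ι → X) ℂ) e = 1 := by
  ext a b
  simp only [localOp, Matrix.one_apply]
  by_cases h : a = b
  · subst h
    have : AgreeOff e a a := fun j _ => rfl
    simp [this]
  · rw [if_neg h]
    split_ifs with h1 h2
    · exact absurd (by rw [← h1.extend_eq, h2]; exact AgreeOff.extend_eq fun j _ => rfl) h
    · rfl
    · rfl

theorem localOp_mul [DecidableEq J] [Fintype ι] [DecidableEq ι] [Fintype X]
    (H K : Matrix (ι → X) (ι → X) ℂ) (e : ι ↪ J) :
    localOp H e * localOp K e = localOp (H * K) e := by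
  classical
  ext a b
  have hd : ∀ w : ι → X, AgreeOff e (Function.extend e w a) b ↔ AgreeOff e a b := fun w => by
    refine forall_congr' fun j => forall_congr' fun hj => ?_
    rw [extend_of_off hj]
  rw [Matrix.mul_apply]
  simp only [localOp, ite_mul, zero_mul, agreeOff_comm (a := a)]
  rw [sum_agree e a (fun z => H (a ∘ e) (z ∘ e) *
    if AgreeOff e z b then K (z ∘ e) (b ∘ e) else 0)]
  simp only [extend_comp_embedding, hd, agreeOff_comm (a := a)]
  split_ifs with h
  · rw [Matrix.mul_apply]
  · simp

end Tensor

/-! ### Lower bounds on the spectrum -/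

section Energy

variable {ι κ σ : Type*}

theorem list_sum_mulVec [Fintype κ] {γ : Type*} (L : List γ) (M : γ → Matrix ι κ ℂ) (ψ : κ → ℂ) :
    (L.map M).sum *ᵥ ψ = (L.map fun c => M c *ᵥ ψ).sum := by
  induction L with
  | nil => simp
  | cons c L ih => simp [add_mulVec, ih]

theorem mul_list_sum [Fintype ι] {γ : Type*} (L : List γ) (T : Matrix κ ι ℂ)
    (M : γ → Matrix ι σ ℂ) : T * (L.map M).sum = (L.map fun c => T * M c).sum := by
  induction L with
  | nil => simp
  | cons c L ih => simp [Matrix.mul_add, ih]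

open Classical in
/-- The operator that acts as `m` on the first factor of `σ × κ` and as the identity on the second
one. -/
noncomputable def withSpectators (e : ι ≃ σ × κ) (m : Matrix σ σ ℂ) : Matrix ι ι ℂ :=
  fun a b => if (e a).2 = (e b).2 then m (e a).1 (e b).1 else 0

theorem withSpectators_list_sum {γ : Type*} (e : ι ≃ σ × κ) (L : List γ) (m : γ → Matrix σ σ ℂ) :
    (L.map fun c => withSpectators e (m c)).sum = withSpectators e (L.map m).sum := by
  induction L with
  | nil => ext a b; simp [withSpectators]
  | cons c L ih =>
    rw [List.map_cons, List.sum_cons, ih]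
    ext a b
    simp only [withSpectators, Matrix.add_apply, List.map_cons, List.sum_cons]
    split_ifs <;> simp

variable [Fintype ι] [Fintype κ] [Fintype σ]

/-- `⟨ψ|M|ψ⟩ ≥ b ⟨ψ|ψ⟩` for every vector `ψ`. -/
def BoundedBelow (M : Matrix ι ι ℂ) (b : ℝ) : Prop :=
  ∀ ψ : ι → ℂ, b * (star ψ ⬝ᵥ ψ).re ≤ (star ψ ⬝ᵥ M *ᵥ ψ).re

open ComplexOrder in
theorem normSq_nonneg (ψ : ι → ℂ) : 0 ≤ (star ψ ⬝ᵥ ψ).re :=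
  (Complex.le_def.1 (dotProduct_star_self_nonneg ψ)).1

open ComplexOrder in
theorem normSq_pos {ψ : ι → ℂ} (h : ψ ≠ 0) : 0 < (star ψ ⬝ᵥ ψ).re :=
  (Complex.lt_def.1 (dotProduct_star_self_pos_iff.2 h)).1

theorem BoundedBelow.mono {M : Matrix ι ι ℂ} {b c : ℝ} (h : BoundedBelow M b) (hc : c ≤ b) :
    BoundedBelow M c :=
  fun ψ => (mul_le_mul_of_nonneg_right hc (normSq_nonneg ψ)).trans (h ψ)

theorem star_dotProduct_conjTranspose_mulVec (T : Matrix κ ι ℂ) (φ : ι → ℂ) (χ : κ → ℂ) :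
    star φ ⬝ᵥ Tᴴ *ᵥ χ = star (T *ᵥ φ) ⬝ᵥ χ := by
  rw [star_mulVec, dotProduct_mulVec]

/-- The form of an orthogonal projector is the squared norm of the projection. -/
theorem projector_form {P : Matrix ι ι ℂ} (h : P.IsHermitian) (h' : P * P = P) (ψ : ι → ℂ) :
    star ψ ⬝ᵥ P *ᵥ ψ = star (P *ᵥ ψ) ⬝ᵥ (P *ᵥ ψ) := by
  rw [← star_dotProduct_conjTranspose_mulVec, h.eq, mulVec_mulVec, h']

theorem projector_form_nonneg {P : Matrix ι ι ℂ} (h : P.IsHermitian) (h' : P * P = P) (ψ : ι → ℂ) :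
    0 ≤ (star ψ ⬝ᵥ P *ᵥ ψ).re := by
  rw [projector_form h h']; exact normSq_nonneg _

/-- Compression along an isometry. -/
theorem BoundedBelow.compress [DecidableEq κ] {M : Matrix ι ι ℂ} {m : Matrix κ κ ℂ}
    {V : Matrix ι κ ℂ} (hV : Vᴴ * V = 1) (hM : M * V = V * m) {b : ℝ} (h : BoundedBelow M b) :
    BoundedBelow m b := by
  intro ψ
  have h1 := h (V *ᵥ ψ)
  rwa [mulVec_mulVec, hM, ← mulVec_mulVec, ← star_dotProduct_conjTranspose_mulVec,
    ← star_dotProduct_conjTranspose_mulVec, mulVec_mulVec, mulVec_mulVec, hV, one_mulVec,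
    one_mulVec] at h1

theorem re_dotProduct_list_sum {γ : Type*} (L : List γ) (χ : ι → ℂ) (v : γ → ι → ℂ) :
    (χ ⬝ᵥ (L.map v).sum).re = (L.map fun c => (χ ⬝ᵥ v c).re).sum := by
  induction L with
  | nil => simp
  | cons c L ih => simp [dotProduct_add, ih]

theorem form_list_sum {γ : Type*} (L : List γ) (M : γ → Matrix ι ι ℂ) (ψ : ι → ℂ) :
    (star ψ ⬝ᵥ (L.map M).sum *ᵥ ψ).re = (L.map fun c => (star ψ ⬝ᵥ M c *ᵥ ψ).re).sum := by
  rw [list_sum_mulVec, re_dotProduct_list_sum]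

/-- A sum of terms `M' c` is bounded below if a resolution of the identity `∑ Tᴴ T = 1` turns each
term into a nonnegative operator `M c` or into the identity, and the former ones, if alone, add up
to an operator that is bounded below. -/
theorem BoundedBelow.of_resolution {γ T : Type*} [Fintype T] [DecidableEq ι] (L : List γ)
    (M' : γ → Matrix ι ι ℂ)
    (M : γ → Matrix κ κ ℂ) (hM : ∀ c ψ, 0 ≤ (star ψ ⬝ᵥ M c *ᵥ ψ).re)
    (t : T → Matrix κ ι ℂ) (ht : ∑ τ, (t τ)ᴴ * t τ = 1)
    (good : T → γ → Prop) (hg : ∀ τ c, good τ c → t τ * M' c = M c * t τ)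
    (hb : ∀ τ c, ¬ good τ c → t τ * M' c = t τ)
    {b : ℝ} (h : BoundedBelow (L.map M).sum b) : BoundedBelow (L.map M').sum (min b 1) := by
  intro φ
  -- Inserting the resolution splits both forms into sectors τ, and the bound is proved in each
  -- sector.
  have res : ∀ χ : ι → ℂ, star φ ⬝ᵥ χ = ∑ τ, star (t τ *ᵥ φ) ⬝ᵥ (t τ *ᵥ χ) := by
    intro χ
    conv_lhs => rw [← one_mulVec χ, ← ht, sum_mulVec, dotProduct_sum]
    exact Finset.sum_congr rfl fun τ _ => by
      rw [← mulVec_mulVec, star_dotProduct_conjTranspose_mulVec]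
  rw [res φ, res, Complex.re_sum, Complex.re_sum, Finset.mul_sum]
  refine Finset.sum_le_sum fun τ _ => ?_
  set χ := t τ *ᵥ φ with hχ
  have e : (star χ ⬝ᵥ t τ *ᵥ (L.map M').sum *ᵥ φ).re =
      (L.map fun c => (star χ ⬝ᵥ (t τ * M' c) *ᵥ φ).re).sum := by
    rw [← re_dotProduct_list_sum, ← list_sum_mulVec, mulVec_mulVec, mul_list_sum]
  rw [e]
  have nn := normSq_nonneg χ
  have hgood : ∀ c, good τ c → (star χ ⬝ᵥ (t τ * M' c) *ᵥ φ).re = (star χ ⬝ᵥ M c *ᵥ χ).re := by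
    intro c hc
    rw [hg τ c hc, ← mulVec_mulVec]
  have hbad : ∀ c, ¬ good τ c → (star χ ⬝ᵥ (t τ * M' c) *ᵥ φ).re = (star χ ⬝ᵥ χ).re := by
    intro c hc
    rw [hb τ c hc]
  by_cases hall : ∀ c ∈ L, good τ c
  · rw [List.map_congr_left fun c hc => hgood c (hall c hc), ← form_list_sum]
    exact (mul_le_mul_of_nonneg_right (min_le_left _ _) nn).trans (h χ)
  · push Not at hall
    obtain ⟨c, hcL, hc⟩ := hall
    -- One bad clause already contributes the squared norm of the sector, and the other terms are
    -- nonnegative.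
    calc _ ≤ 1 * (star χ ⬝ᵥ χ).re := mul_le_mul_of_nonneg_right (min_le_right _ _) nn
      _ = (star χ ⬝ᵥ (t τ * M' c) *ᵥ φ).re := by rw [hbad c hc, one_mul]
      _ ≤ _ := List.single_le_sum (by
        intro x hx
        obtain ⟨c', -, rfl⟩ := List.mem_map.1 hx
        by_cases hc' : good τ c'
        · rw [hgood c' hc']; exact hM c' χ
        · rw [hbad c' hc']; exact nn) _ (List.mem_map.2 ⟨c, hcL, rfl⟩)

/-- The form of m ⊗ 1 is the sum of the forms of m over the slices with fixed spectators; a vector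
supported on one slice gives the converse. -/
theorem boundedBelow_withSpectators [Nonempty κ] (e : ι ≃ σ × κ) (m : Matrix σ σ ℂ) (b : ℝ) :
    BoundedBelow (withSpectators e m) b ↔ BoundedBelow m b := by
  classical
  have form : ∀ (ψ : ι → ℂ), star ψ ⬝ᵥ withSpectators e m *ᵥ ψ =
      ∑ y, star (fun x => ψ (e.symm (x, y))) ⬝ᵥ m *ᵥ fun x => ψ (e.symm (x, y)) := by
    intro ψ
    simp only [dotProduct, mulVec, withSpectators, Pi.star_apply]
    rw [← e.symm.sum_comp, Fintype.sum_prod_type_right]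
    refine Finset.sum_congr rfl fun y _ => Finset.sum_congr rfl fun x _ => ?_
    congr 1
    rw [← e.symm.sum_comp, Fintype.sum_prod_type]
    refine Finset.sum_congr rfl fun x' _ => ?_
    simp
  have norm : ∀ (ψ : ι → ℂ), star ψ ⬝ᵥ ψ =
      ∑ y, star (fun x => ψ (e.symm (x, y))) ⬝ᵥ fun x => ψ (e.symm (x, y)) := by
    intro ψ
    simp only [dotProduct, Pi.star_apply]
    rw [← e.symm.sum_comp, Fintype.sum_prod_type_right]
  constructor
  · intro h ψ
    obtain ⟨y₀⟩ := ‹Nonempty κ›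
    have h1 := h fun a => if (e a).2 = y₀ then ψ (e a).1 else 0
    rw [form, norm, Finset.sum_eq_single y₀, Finset.sum_eq_single y₀] at h1
    · simpa using h1
    all_goals simp +contextual [dotProduct]
  · intro h ψ
    rw [form, norm, Complex.re_sum, Complex.re_sum, Finset.mul_sum]
    exact Finset.sum_le_sum fun y _ => h _

/-- A positive definite form on a finite-dimensional space is bounded below by a positive
constant. -/
theorem exists_boundedBelow {M : Matrix ι ι ℂ} (h : ∀ ψ, ψ ≠ 0 → 0 < (star ψ ⬝ᵥ M *ᵥ ψ).re) :
    ∃ b > 0, BoundedBelow M b := by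
  rcases isEmpty_or_nonempty ι with hι | hι
  · exact ⟨1, one_pos, fun ψ => by simp [dotProduct]⟩
  have hc : Continuous fun ψ : ι → ℂ => (star ψ ⬝ᵥ M *ᵥ ψ).re := by
    simp only [dotProduct, mulVec, Pi.star_apply]
    fun_prop
  -- The form attains its minimum on the compact unit sphere. This is the sphere of the sup norm,
  -- whence the factor `Fintype.card ι` in the comparison with the Euclidean norm.
  obtain ⟨u, hu, hmin⟩ := (isCompact_sphere (0 : ι → ℂ) 1).exists_isMinOn
    (NormedSpace.sphere_nonempty.2 zero_le_one) hc.continuousOn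
  have hu0 : u ≠ 0 := by
    rintro rfl
    simp at hu
  set m := (star u ⬝ᵥ M *ᵥ u).re
  have hm : 0 < m := h u hu0
  have hcard : (0 : ℝ) < Fintype.card ι := by exact_mod_cast Fintype.card_pos
  refine ⟨m / Fintype.card ι, by positivity, fun ψ => ?_⟩
  by_cases hψ : ψ = 0
  · simp [hψ]
  have hn : 0 < ‖ψ‖ := norm_pos_iff.2 hψ
  have h1 : m ≤ (star ((‖ψ‖⁻¹ : ℂ) • ψ) ⬝ᵥ M *ᵥ ((‖ψ‖⁻¹ : ℂ) • ψ)).re :=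
    hmin (by simp [norm_smul, hn.ne'])
  have h2 : (star ((‖ψ‖⁻¹ : ℂ) • ψ) ⬝ᵥ M *ᵥ ((‖ψ‖⁻¹ : ℂ) • ψ)).re =
      (star ψ ⬝ᵥ M *ᵥ ψ).re / ‖ψ‖ ^ 2 := by
    rw [star_smul, mulVec_smul, smul_dotProduct, dotProduct_smul, smul_smul, smul_eq_mul]
    have : star (‖ψ‖⁻¹ : ℂ) * (‖ψ‖⁻¹ : ℂ) = ((‖ψ‖ ^ 2)⁻¹ : ℝ) := by
      simp [sq]
    rw [this, Complex.re_ofReal_mul]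
    field_simp
  have h3 : (star ψ ⬝ᵥ ψ).re ≤ Fintype.card ι * ‖ψ‖ ^ 2 := by
    have : ∀ i, (star (ψ i) * ψ i).re ≤ ‖ψ‖ ^ 2 := fun i => by
      have e : (star (ψ i) * ψ i).re = ‖ψ i‖ ^ 2 := by
        rw [Complex.star_def, ← Complex.normSq_eq_conj_mul_self, Complex.ofReal_re,
          Complex.normSq_eq_norm_sq]
      rw [e]
      gcongr
      exact norm_le_pi_norm ψ i
    calc (star ψ ⬝ᵥ ψ).re = ∑ i, (star (ψ i) * ψ i).re := by simp [dotProduct]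
      _ ≤ ∑ i : ι, ‖ψ‖ ^ 2 := Finset.sum_le_sum fun i _ => this i
      _ = _ := by simp
  rw [h2, le_div_iff₀ (by positivity)] at h1
  calc m / Fintype.card ι * (star ψ ⬝ᵥ ψ).re
      ≤ m / Fintype.card ι * (Fintype.card ι * ‖ψ‖ ^ 2) := by gcongr
    _ = m * ‖ψ‖ ^ 2 := by field_simp
    _ ≤ _ := h1

end Energy

/-! ### Satisfiability in terms of lower bounds on the energy -/

namespace QCSP

variable {d : ℕ} {C : QCSP d}

theorem Placed.op_isHermitian {n : ℕ} (c : C.Placed n) : c.op.IsHermitian := by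
  rw [Placed.op, extendOp_eq_localOp]
  exact localOp_isHermitian (C.clause_hermitian _) _

theorem Placed.op_mul_op {n : ℕ} (c : C.Placed n) : c.op * c.op = c.op := by
  rw [Placed.op, extendOp_eq_localOp, localOp_mul, C.clause_idempotent]

namespace Instance

theorem energyAtLeast_iff (I : C.Instance) (b : ℝ) :
    I.EnergyAtLeast b ↔ BoundedBelow (I.clauses.map Placed.op).sum b := Iff.rfl

theorem Satisfiable.not_energyAtLeast {I : C.Instance} (h : I.Satisfiable) {b : ℝ} (hb : 0 < b) :
    ¬ I.EnergyAtLeast b := by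
  obtain ⟨ψ, hψ, hc⟩ := h
  intro hE
  have h1 := (I.energyAtLeast_iff b).1 hE ψ
  rw [form_list_sum, List.sum_eq_zero] at h1
  · exact absurd h1 (not_le.2 (mul_pos hb (normSq_pos hψ)))
  · intro x hx
    obtain ⟨c, hcI, rfl⟩ := List.mem_map.1 hx
    simp [hc c hcI]

/-- The energy of ψ is a sum of squared norms of projections, so it vanishes only if every clause
annihilates ψ; unsatisfiability therefore makes the form positive definite. -/
theorem exists_energyAtLeast {I : C.Instance} (h : ¬ I.Satisfiable) :
    ∃ b > 0, I.EnergyAtLeast b := by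
  refine exists_boundedBelow (M := (I.clauses.map Placed.op).sum) fun ψ hψ => ?_
  rw [form_list_sum]
  have hnn : ∀ x ∈ I.clauses.map fun c => (star ψ ⬝ᵥ c.op *ᵥ ψ).re, 0 ≤ x := by
    intro x hx
    obtain ⟨c, -, rfl⟩ := List.mem_map.1 hx
    exact projector_form_nonneg c.op_isHermitian c.op_mul_op ψ
  refine lt_of_le_of_ne (List.sum_nonneg hnn) fun h0 => h ⟨ψ, hψ, fun c hc => ?_⟩
  have h1 : (star ψ ⬝ᵥ c.op *ᵥ ψ).re ≤ 0 := by
    rw [h0]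
    exact List.single_le_sum hnn _ (List.mem_map.2 ⟨c, hc, rfl⟩)
  by_contra h2
  rw [projector_form c.op_isHermitian c.op_mul_op] at h1
  exact absurd h1 (not_le.2 (normSq_pos h2))

end Instance

end QCSP

/-! ### Encoding the sites of a local projector into larger sites -/

section Encode

theorem tensorMat_isometry {ι X K : Type*} [DecidableEq X] [Fintype K] [Fintype ι]
    [DecidableEq ι] {V : Matrix K X ℂ} (hV : Vᴴ * V = 1) :
    (tensorMat fun _ : ι => V)ᴴ * (tensorMat fun _ : ι => V) = 1 := by
  rw [tensorMat_conjTranspose, tensorMat_mul, hV, tensorMat_one]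

variable {ι J X K : Type*} [Fintype X] [DecidableEq X] [DecidableEq K]
  [Fintype ι] [DecidableEq ι]

/-- The projector whose kernel is the image of the kernel of `h` under the tensor power of `V`. -/
def encodeClause (V : Matrix K X ℂ) (h : Matrix (ι → X) (ι → X) ℂ) :
    Matrix (ι → K) (ι → K) ℂ :=
  1 - tensorMat (fun _ : ι => V) * (1 - h) * (tensorMat fun _ : ι => V)ᴴ

theorem encodeClause_isHermitian (V : Matrix K X ℂ) {h : Matrix (ι → X) (ι → X) ℂ}
    (hh : h.IsHermitian) : (encodeClause V h).IsHermitian := by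
  rw [Matrix.IsHermitian, encodeClause, conjTranspose_sub, conjTranspose_mul, conjTranspose_mul,
    conjTranspose_sub, hh.eq, conjTranspose_one, conjTranspose_one, conjTranspose_conjTranspose,
    Matrix.mul_assoc]

variable [Fintype K] [Fintype J] [DecidableEq J]

theorem encodeClause_mul_self {V : Matrix K X ℂ} (hV : Vᴴ * V = 1)
    {h : Matrix (ι → X) (ι → X) ℂ} (hh : h * h = h) :
    encodeClause V h * encodeClause V h = encodeClause V h := by
  have hA := tensorMat_isometry (ι := ι) hV
  rw [encodeClause]
  generalize (tensorMat fun _ : ι => V) = A at hA ⊢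
  have h1 : (1 - h) * (1 - h) = 1 - h := by
    rw [Matrix.sub_mul, Matrix.mul_sub, Matrix.mul_sub, hh]; simp
  have h2 : A * (1 - h) * Aᴴ * (A * (1 - h) * Aᴴ) = A * (1 - h) * Aᴴ := by
    calc _ = A * ((1 - h) * ((Aᴴ * A) * (1 - h))) * Aᴴ := by simp only [Matrix.mul_assoc]
      _ = _ := by rw [hA, Matrix.one_mul, h1]
  generalize A * (1 - h) * Aᴴ = Q at h2 ⊢
  rw [Matrix.sub_mul, Matrix.mul_sub, Matrix.mul_sub, h2]; simp

theorem encodeClause_mul_tensorMat {V : Matrix K X ℂ} (hV : Vᴴ * V = 1)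
    (h : Matrix (ι → X) (ι → X) ℂ) :
    encodeClause V h * (tensorMat fun _ : ι => V) = (tensorMat fun _ : ι => V) * h := by
  have hA := tensorMat_isometry (ι := ι) hV
  rw [encodeClause, Matrix.sub_mul, Matrix.mul_assoc, hA]
  simp [Matrix.mul_sub]

theorem conjTranspose_mul_encodeClause {V : Matrix K X ℂ} (hV : Vᴴ * V = 1)
    (h : Matrix (ι → X) (ι → X) ℂ) :
    (tensorMat fun _ : ι => V)ᴴ * encodeClause V h = h * (tensorMat fun _ : ι => V)ᴴ := by
  have hA := tensorMat_isometry (ι := ι) hV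
  rw [encodeClause, Matrix.mul_sub, ← Matrix.mul_assoc, ← Matrix.mul_assoc, hA]
  simp [Matrix.sub_mul]

/-- Operators on one site that resolve the identity: first the adjoint of `V`, then operators that
vanish on the range of `V`. -/
def siteResolution (V : Matrix K X ℂ) (x₀ : X) : Option K → Matrix X K ℂ
  | none => Vᴴ
  -- There is one outcome for each row k of the complementary projector; since the output is indexed
  -- by X, this row is stored at the arbitrary index x₀.
  | some k => fun x y => if x = x₀ then (1 - V * Vᴴ : Matrix K K ℂ) k y else 0

theorem siteResolution_some_mul {V : Matrix K X ℂ} (hV : Vᴴ * V = 1) (x₀ : X) (k : K) :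
    siteResolution V x₀ (some k) * V = 0 := by
  have h : (1 - V * Vᴴ) * V = 0 := by
    rw [Matrix.sub_mul, Matrix.mul_assoc, hV]; simp
  ext x y
  have h' := congrFun (congrFun h k) y
  rw [Matrix.mul_apply] at h' ⊢
  by_cases hx : x = x₀ <;> simp [siteResolution, hx]
  simpa using h'

theorem sum_siteResolution {V : Matrix K X ℂ} (hV : Vᴴ * V = 1) (x₀ : X) :
    ∑ o, (siteResolution V x₀ o)ᴴ * siteResolution V x₀ o = 1 := by
  have hQ : (1 - V * Vᴴ)ᴴ * (1 - V * Vᴴ) = 1 - V * Vᴴ := by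
    have : V * Vᴴ * (V * Vᴴ) = V * Vᴴ := by
      calc _ = V * (Vᴴ * V) * Vᴴ := by simp only [Matrix.mul_assoc]
        _ = _ := by rw [hV]; simp
    rw [conjTranspose_sub, conjTranspose_mul, conjTranspose_conjTranspose, conjTranspose_one,
      Matrix.sub_mul, Matrix.mul_sub, Matrix.mul_sub, this]
    simp
  have : ∑ k, (siteResolution V x₀ (some k))ᴴ * siteResolution V x₀ (some k) = 1 - V * Vᴴ := by
    rw [← hQ]
    ext a b
    rw [Matrix.sum_apply, Matrix.mul_apply]
    refine Finset.sum_congr rfl fun k _ => ?_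
    rw [Matrix.mul_apply, Finset.sum_eq_single x₀]
    · rw [conjTranspose_apply, conjTranspose_apply]
      simp [siteResolution]
    · intro x _ hx
      simp [siteResolution, hx]
    · simp
  rw [Fintype.sum_option, this]
  simp [siteResolution]

variable {γ : Type*} {m : γ → ℕ}

/-- A sum of encoded clauses has no smaller ground state energy than the sum of the clauses, as
long as this is at most `1`. -/
theorem BoundedBelow.encode [Nonempty X] {V : Matrix K X ℂ} (hV : Vᴴ * V = 1) (L : List γ)
    (h : ∀ c, Matrix (Fin (m c) → X) (Fin (m c) → X) ℂ) (hh : ∀ c, (h c).IsHermitian)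
    (hh' : ∀ c, h c * h c = h c) (e : ∀ c, Fin (m c) ↪ J) {b : ℝ}
    (H : BoundedBelow (L.map fun c => localOp (h c) (e c)).sum b) :
    BoundedBelow (L.map fun c => localOp (encodeClause V (h c)) (e c)).sum (min b 1) := by
  obtain ⟨x₀⟩ := ‹Nonempty X›
  -- The outcome τ tells for each site whether it is in the code space; a clause is good if all of
  -- its sites are.
  refine H.of_resolution L (fun c => localOp (encodeClause V (h c)) (e c))
    (fun c => localOp (h c) (e c)) (fun c ψ => projector_form_nonneg
      (localOp_isHermitian (hh c) _) (by rw [localOp_mul, hh']) ψ)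
    (T := J → Option K) (fun τ => tensorMat fun j => siteResolution V x₀ (τ j)) ?_
    (fun τ c => ∀ i, τ (e c i) = none) (fun τ c hτ => ?_) (fun τ c hτ => ?_)
  · rw [sum_tensorMat_conjTranspose_mul, sum_siteResolution hV, tensorMat_one]
  · refine tensorMat_mul_localOp _ _ ?_
    simp only [hτ, siteResolution]
    rw [← tensorMat_conjTranspose, conjTranspose_mul_encodeClause hV]
  -- If a site of the clause has left the code space, the factor there kills V, and of the encoded
  -- clause only the summand 1 remains.
  · have := tensorMat_mul_localOp (fun j => siteResolution V x₀ (τ j)) (e c) (H := 1)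
      (H' := encodeClause V (h c)) ?_
    · rw [this, localOp_one, Matrix.one_mul]
    push Not at hτ
    obtain ⟨i, hi⟩ := hτ
    obtain ⟨k, hk⟩ := Option.ne_none_iff_exists'.1 hi
    have h0 : (tensorMat fun i => siteResolution V x₀ (τ (e c i))) *
        (tensorMat fun _ : Fin (m c) => V) = 0 := by
      rw [tensorMat_mul]
      refine tensorMat_eq_zero (j := i) ?_
      rw [hk, siteResolution_some_mul hV]
    rw [encodeClause, Matrix.mul_sub, ← Matrix.mul_assoc, ← Matrix.mul_assoc, h0]
    simp

/-- The tensor power of V is an isometry that intertwines the two sums, so the lower bound passes to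
the compression. -/
theorem BoundedBelow.decode {V : Matrix K X ℂ} (hV : Vᴴ * V = 1) (L : List γ)
    (h : ∀ c, Matrix (Fin (m c) → X) (Fin (m c) → X) ℂ) (e : ∀ c, Fin (m c) ↪ J) {b : ℝ}
    (H : BoundedBelow (L.map fun c => localOp (encodeClause V (h c)) (e c)).sum b) :
    BoundedBelow (L.map fun c => localOp (h c) (e c)).sum b := by
  refine H.compress (tensorMat_isometry hV) ?_
  rw [mul_list_sum]
  have : ∀ c, localOp (encodeClause V (h c)) (e c) * (tensorMat fun _ : J => V) =
      (tensorMat fun _ : J => V) * localOp (h c) (e c) := fun c =>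
    (tensorMat_mul_localOp (fun _ : J => V) (e c) (H := encodeClause V (h c)) (H' := h c)
      (encodeClause_mul_tensorMat hV (h c)).symm).symm
  simp only [← this]
  clear H
  induction L with
  | nil => simp
  | cons c L ih =>
    rw [List.map_cons, List.sum_cons, Matrix.add_mul, ih, List.map_cons, List.sum_cons]

end Encode

/-! ### Spectator sites and the regrouping of sites -/

section Split

variable {ι J N Y : Type*}

open Classical in
/-- Configurations on `N` split into their restrictions to the range of `α` and to its
complement. -/
noncomputable def splitEquiv (α : J ↪ N) : (N → Y) ≃ (J → Y) × ({i // ∀ j, α j ≠ i} → Y) where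
  toFun a := (a ∘ α, fun i => a i)
  invFun p i := if h : ∀ j, α j ≠ i then p.2 ⟨i, h⟩
    else p.1 (by simpa using h : ∃ j, α j = i).choose
  left_inv a := by
    ext i
    dsimp only
    split_ifs with h
    · rfl
    · exact congrArg a (by simpa using h : ∃ j, α j = i).choose_spec
  right_inv p := by
    ext i
    · have h : ¬ ∀ j, α j ≠ α i := fun h => h i rfl
      simp only [Function.comp, dif_neg h]
      exact congrArg p.1 (α.injective (by simp : ∃ j, α j = α i).choose_spec)
    · simp only [dif_pos i.2]

theorem localOp_trans (H : Matrix (ι → Y) (ι → Y) ℂ) (e : ι ↪ J) (α : J ↪ N) :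
    localOp H (e.trans α) = withSpectators (splitEquiv α) (localOp H e) := by
  ext a b
  have : AgreeOff (e.trans α) a b ↔ (splitEquiv α a).2 = (splitEquiv α b).2 ∧
      AgreeOff e (a ∘ α) (b ∘ α) := by
    constructor
    · intro h
      refine ⟨funext fun i => h i.1 fun j => i.2 _, fun j hj => h _ fun i hi => hj i ?_⟩
      exact α.injective hi
    · rintro ⟨h1, h2⟩ i hi
      by_cases h : ∃ j, α j = i
      · obtain ⟨j, rfl⟩ := h
        exact h2 j fun i' hi' => hi i' (by simp [hi'])
      · exact congrFun h1 ⟨i, by simpa using h⟩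
  have e1 : (splitEquiv α a).1 = a ∘ α := rfl
  have e2 : (splitEquiv α b).1 = b ∘ α := rfl
  simp only [localOp, withSpectators, e1, e2]
  by_cases h1 : (splitEquiv α a).2 = (splitEquiv α b).2
  · classical exact (if_congr (this.trans (and_iff_right h1)) rfl rfl).trans (if_pos h1).symm
  · rw [if_neg h1, if_neg fun h => h1 (this.1 h).1]

theorem localOp_prodMap {r : Type*} (H : Matrix (ι → r → Y) (ι → r → Y) ℂ) (e : ι ↪ J) :
    localOp (H.submatrix (Equiv.curry ι r Y) (Equiv.curry ι r Y))
      (e.prodMap (Function.Embedding.refl r)) =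
    (localOp H e).submatrix (Equiv.curry J r Y) (Equiv.curry J r Y) := by
  ext a b
  have : AgreeOff (e.prodMap (Function.Embedding.refl r)) a b ↔
      AgreeOff e (Equiv.curry J r Y a) (Equiv.curry J r Y b) := by
    constructor
    · intro h j hj
      ext i
      exact h (j, i) fun p hp => hj p.1 (congrArg Prod.fst hp)
    · rintro h ⟨j, i⟩ hj
      exact congrFun (h j fun i' hi' => hj (i', i) (by simp [hi'])) i
  simp only [localOp, submatrix_apply]
  classical exact if_congr this rfl rfl

theorem localOp_equiv {ι' : Type*} (ε : ι' ≃ ι) (H : Matrix (ι → Y) (ι → Y) ℂ) (e : ι' ↪ J) :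
    localOp (H.submatrix (fun a => a ∘ ε.symm) fun a => a ∘ ε.symm) e =
      localOp H (ε.symm.toEmbedding.trans e) := by
  ext a b
  have : AgreeOff e a b ↔ AgreeOff (ε.symm.toEmbedding.trans e) a b := by
    refine forall_congr' fun j => imp_congr_left ?_
    exact ε.symm.forall_congr_right (q := fun i => e i ≠ j) |>.symm
  simp only [localOp, submatrix_apply]
  classical exact if_congr this rfl rfl

end Split

/-! ### The encoded QCSP and the comparison through abstract sites -/

namespace QCSP

/-- Configurations of `m * r` qubits as configurations of `m` blocks of `r` qubits. -/
def blockEquiv (m r : ℕ) : (Fin (m * r) → Fin 2) ≃ (Fin m → Fin r → Fin 2) :=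
  (finProdFinEquiv.symm.arrowCongr (Equiv.refl _)).trans (Equiv.curry _ _ _)

variable {d r : ℕ}

/-- The QCSP on qubits whose clauses are those of `C`, with every qudit encoded into `r` qubits by
the isometry `V`. -/
def encode (C : QCSP d) (V : Matrix (Fin r → Fin 2) (Fin d) ℂ) (hV : Vᴴ * V = 1) : QCSP 2 where
  numTypes := C.numTypes
  arity i := C.arity i * r
  clause i := (encodeClause V (C.clause i)).submatrix (blockEquiv _ r) (blockEquiv _ r)
  clause_hermitian i := (encodeClause_isHermitian V (C.clause_hermitian i)).submatrix _
  clause_idempotent i := by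
    rw [submatrix_mul_equiv, encodeClause_mul_self hV (C.clause_idempotent i)]

/-- A clause type applied to an ordered tuple of distinct elements of `J`. -/
structure SiteClause (C : QCSP d) (J : Type*) where
  type : Fin C.numTypes
  args : Fin (C.arity type) ↪ J

variable {C : QCSP d} {J : Type*}

/-- The clause on `n` qudits obtained by numbering the sites. -/
def SiteClause.toQudits {n : ℕ} (α : J ↪ Fin n) (c : C.SiteClause J) : C.Placed n :=
  ⟨c.type, c.args.trans α⟩

/-- The clause on `n` qubits obtained by assigning to each site a block of `r` qubits. -/
def SiteClause.toQubits {V : Matrix (Fin r → Fin 2) (Fin d) ℂ} (hV : Vᴴ * V = 1) {n : ℕ}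
    (β : J × Fin r ↪ Fin n) (c : C.SiteClause J) : (C.encode V hV).Placed n :=
  ⟨c.type, finProdFinEquiv.symm.toEmbedding.trans
    ((c.args.prodMap (Function.Embedding.refl (Fin r))).trans β)⟩

/-- An instance on qudits and one on qubits are compared through operators on a common set of sites
J; numbering the sites, or assigning blocks to them, only adds spectators. The same comparison then
serves both reductions. -/
theorem SiteClause.toQudits_op {n : ℕ} (α : J ↪ Fin n) (c : C.SiteClause J) :
    (c.toQudits α).op = withSpectators (splitEquiv α) (localOp (C.clause c.type) c.args) := by
  rw [Placed.op, extendOp_eq_localOp]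
  exact localOp_trans _ _ _

theorem SiteClause.toQubits_op {V : Matrix (Fin r → Fin 2) (Fin d) ℂ} (hV : Vᴴ * V = 1) {n : ℕ}
    (β : J × Fin r ↪ Fin n) (c : C.SiteClause J) :
    (c.toQubits hV β).op =
      withSpectators
        ((splitEquiv β).trans ((Equiv.curry J (Fin r) (Fin 2)).prodCongr (Equiv.refl _)))
        (localOp (encodeClause V (C.clause c.type)) c.args) := by
  rw [Placed.op, extendOp_eq_localOp]
  have h1 := localOp_equiv finProdFinEquiv.symm ((encodeClause V (C.clause c.type)).submatrix
    (Equiv.curry (Fin (C.arity c.type)) (Fin r) (Fin 2)) (Equiv.curry _ _ _))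
    (finProdFinEquiv.symm.toEmbedding.trans
      ((c.args.prodMap (Function.Embedding.refl (Fin r))).trans β))
  have h2 : finProdFinEquiv.symm.symm.toEmbedding.trans (finProdFinEquiv.symm.toEmbedding.trans
        ((c.args.prodMap (Function.Embedding.refl (Fin r))).trans β)) =
      (c.args.prodMap (Function.Embedding.refl (Fin r))).trans β := by
    ext x
    simp
  rw [h2] at h1
  refine h1.trans ?_
  rw [localOp_trans, localOp_prodMap]
  rfl

variable [Fintype J] [DecidableEq J]

theorem energyAtLeast_toQubits_iff {V : Matrix (Fin r → Fin 2) (Fin d) ℂ} (hV : Vᴴ * V = 1) {n : ℕ}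
    (β : J × Fin r ↪ Fin n) (L : List (C.SiteClause J)) (b : ℝ) :
    (⟨n, L.map (SiteClause.toQubits hV β)⟩ : (C.encode V hV).Instance).EnergyAtLeast b ↔
      BoundedBelow (L.map fun c => localOp (encodeClause V (C.clause c.type)) c.args).sum b := by
  rw [Instance.energyAtLeast_iff]
  simp only [List.map_map]
  rw [← boundedBelow_withSpectators ((splitEquiv β).trans
    ((Equiv.curry J (Fin r) (Fin 2)).prodCongr (Equiv.refl _))), ← withSpectators_list_sum]
  simp only [← SiteClause.toQubits_op hV]
  rfl

theorem energyAtLeast_toQudits_iff [NeZero d] {n : ℕ} (α : J ↪ Fin n) (L : List (C.SiteClause J))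
    (b : ℝ) : (⟨n, L.map (SiteClause.toQudits α)⟩ : C.Instance).EnergyAtLeast b ↔
      BoundedBelow (L.map fun c => localOp (C.clause c.type) c.args).sum b := by
  rw [Instance.energyAtLeast_iff]
  simp only [List.map_map]
  rw [← boundedBelow_withSpectators (splitEquiv α), ← withSpectators_list_sum]
  simp only [← SiteClause.toQudits_op]
  rfl

/-- An instance on qudits and its encoding into blocks of qubits: the ground state energies. -/
theorem energyAtLeast_toQudits [NeZero d] {V : Matrix (Fin r → Fin 2) (Fin d) ℂ}
    (hV : Vᴴ * V = 1) {n n' : ℕ} (α : J ↪ Fin n) (β : J × Fin r ↪ Fin n')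
    (L : List (C.SiteClause J)) {b : ℝ}
    (h : (⟨n', L.map (SiteClause.toQubits hV β)⟩ : (C.encode V hV).Instance).EnergyAtLeast b) :
    (⟨n, L.map (SiteClause.toQudits α)⟩ : C.Instance).EnergyAtLeast b := by
  rw [energyAtLeast_toQudits_iff]
  rw [energyAtLeast_toQubits_iff] at h
  exact BoundedBelow.decode hV L (fun c => C.clause c.type) (fun c => c.args) h

theorem energyAtLeast_toQubits [NeZero d] {V : Matrix (Fin r → Fin 2) (Fin d) ℂ}
    (hV : Vᴴ * V = 1) {n n' : ℕ} (α : J ↪ Fin n) (β : J × Fin r ↪ Fin n')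
    (L : List (C.SiteClause J)) {b : ℝ}
    (h : (⟨n, L.map (SiteClause.toQudits α)⟩ : C.Instance).EnergyAtLeast b) :
    (⟨n', L.map (SiteClause.toQubits hV β)⟩ : (C.encode V hV).Instance).EnergyAtLeast
      (min b 1) := by
  rw [energyAtLeast_toQudits_iff] at h
  rw [energyAtLeast_toQubits_iff]
  exact BoundedBelow.encode hV L (fun c => C.clause c.type) (fun c => C.clause_hermitian _)
    (fun c => C.clause_idempotent _) (fun c => c.args) h

/-- Satisfiability is the absence of a positive lower bound on the energy, and positive bounds are
transferred in both directions. -/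
theorem satisfiable_toQubits_iff [NeZero d] {V : Matrix (Fin r → Fin 2) (Fin d) ℂ}
    (hV : Vᴴ * V = 1) {n n' : ℕ} (α : J ↪ Fin n) (β : J × Fin r ↪ Fin n')
    (L : List (C.SiteClause J)) :
    (⟨n', L.map (SiteClause.toQubits hV β)⟩ : (C.encode V hV).Instance).Satisfiable ↔
      (⟨n, L.map (SiteClause.toQudits α)⟩ : C.Instance).Satisfiable := by
  constructor
  · intro h
    by_contra h'
    obtain ⟨b, hb, hE⟩ := Instance.exists_energyAtLeast h'
    exact h.not_energyAtLeast (lt_min hb one_pos) (energyAtLeast_toQubits hV α β L hE)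
  · intro h
    by_contra h'
    obtain ⟨b, hb, hE⟩ := Instance.exists_energyAtLeast h'
    exact h.not_energyAtLeast hb (energyAtLeast_toQudits hV α β L hE)

theorem encode_maxArity (C : QCSP d) (V : Matrix (Fin r → Fin 2) (Fin d) ℂ) (hV : Vᴴ * V = 1) :
    (C.encode V hV).maxArity = C.maxArity * r := by
  refine le_antisymm (Finset.sup_le fun i _ => Nat.mul_le_mul_right r
    (Finset.le_sup (f := C.arity) (Finset.mem_univ i))) ?_
  rcases Nat.eq_zero_or_pos r with rfl | hr
  · simp
  rw [← Nat.le_div_iff_mul_le hr]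
  refine Finset.sup_le fun i _ => (Nat.le_div_iff_mul_le hr).2 ?_
  exact Finset.le_sup (f := (C.encode V hV).arity) (Finset.mem_univ i)

end QCSP

/-! ### A generic code that determines the blocks -/

section Generic

/-- Matrices that depend polynomially on parameters and each of which is injective for some value
of the parameters are simultaneously injective for some value. -/
theorem exists_simultaneously_injective {S P : Type*} [Finite S]
    {R Q : Type*} [Fintype R] [Fintype Q]
    (N : S → Matrix R Q (MvPolynomial P ℂ))
    (h : ∀ s, ∃ x : P → ℂ, Function.Injective ((N s).map (MvPolynomial.eval x)).mulVec) :
    ∃ x : P → ℂ, ∀ s, Function.Injective ((N s).map (MvPolynomial.eval x)).mulVec := by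
  classical
  cases nonempty_fintype S
  -- A left inverse of the matrix at one good point, kept constant, turns the matrix into a square
  -- one. Its determinant is a polynomial that is 1 at this point, and wherever it does not vanish
  -- the matrix is injective.
  have key : ∀ s, ∃ q : MvPolynomial P ℂ, q ≠ 0 ∧ ∀ x, MvPolynomial.eval x q ≠ 0 →
      Function.Injective ((N s).map (MvPolynomial.eval x)).mulVec := by
    intro s
    obtain ⟨x, hx⟩ := h s
    obtain ⟨g, hg⟩ := LinearMap.exists_leftInverse_of_injective
      ((N s).map (MvPolynomial.eval x)).mulVecLin (LinearMap.ker_eq_bot.2 hx)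
    have hG : g.toMatrix' * (N s).map (MvPolynomial.eval x) = 1 := by
      rw [← LinearMap.toMatrix'_id, ← hg, LinearMap.toMatrix'_comp,
        ← Matrix.toLin'_apply', LinearMap.toMatrix'_toLin']
    let G : Matrix Q R (MvPolynomial P ℂ) := g.toMatrix'.map MvPolynomial.C
    have hev : ∀ y, MvPolynomial.eval y (G * N s).det =
        (g.toMatrix' * (N s).map (MvPolynomial.eval y)).det := by
      intro y
      rw [RingHom.map_det, RingHom.mapMatrix_apply, Matrix.map_mul]
      congr 2
      ext a b
      simp [G]
    refine ⟨(G * N s).det, fun h0 => ?_, fun y hy => ?_⟩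
    · have := hev x
      rw [h0, hG] at this
      simp at this
    · rw [hev] at hy
      have h1 := Matrix.mulVec_injective_of_isUnit
        ((Matrix.isUnit_iff_isUnit_det _).2 (isUnit_iff_ne_zero.2 hy))
      intro u v huv
      apply h1
      simp only [← mulVec_mulVec, huv]
  choose q hq hq' using key
  have hprod : ∏ s, q s ≠ 0 := Finset.prod_ne_zero_iff.2 fun s _ => hq s
  obtain ⟨x, hx⟩ : ∃ x, MvPolynomial.eval x (∏ s, q s) ≠ 0 := by
    by_contra! h0
    exact hprod (MvPolynomial.funext fun x => by rw [h0 x, map_zero])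
  refine ⟨x, fun s => hq' s x fun h0 => hx ?_⟩
  rw [map_prod]
  exact Finset.prod_eq_zero (Finset.mem_univ s) h0

variable {r M : ℕ}

/-- The vector `φ` is annihilated by the functionals `B` on the block `β` of qubits. -/
def KilledOn {Q : Type*} (B : Matrix (Fin M) (Fin r → Fin 2) ℂ) (β : Fin r ↪ Q)
    (φ : (Q → Fin 2) → ℂ) : Prop :=
  ∀ ρ z, ∑ x, B ρ x * φ (Function.extend β x z) = 0

/-- Two blocks are in conflict if they overlap and are different as ordered tuples. -/
def Conflict {Q : Type*} (β γ : Fin r ↪ Q) : Prop := β ≠ γ ∧ ∃ i j, β i = γ j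

/-- Conflicting blocks cannot both be annihilated by `B`. -/
def Separating (B : Matrix (Fin M) (Fin r → Fin 2) ℂ) (Q : Type*) : Prop :=
  ∀ (β β' : Fin r ↪ Q) (φ : (Q → Fin 2) → ℂ), Conflict β β' → KilledOn B β φ →
    KilledOn B β' φ → φ = 0

theorem extend_self {Q : Type*} (β : Fin r ↪ Q) (y : Q → Fin 2) :
    Function.extend β (y ∘ β) y = y := AgreeOff.extend_eq fun _ _ => rfl

/-- It is enough to separate blocks among `2 r` qubits. -/
theorem Separating.of_sum {B : Matrix (Fin M) (Fin r → Fin 2) ℂ}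
    (h : Separating B (Fin r ⊕ Fin r)) (Q : Type*) : Separating B Q := by
  classical
  intro β β' φ hc hk hk'
  by_contra hφ
  obtain ⟨z₀, hz₀⟩ := Function.ne_iff.1 hφ
  -- A qubit of the second block is identified with its copy in the first block if it is shared and
  -- gets a place in the second summand otherwise.
  let θ : Fin r → Fin r ⊕ Fin r := fun j => if hj : ∃ i, β i = β' j then .inl hj.choose else .inr j
  let κ : Fin r ⊕ Fin r → Q := Sum.elim β β'
  have hκ : ∀ j, κ (θ j) = β' j := by
    intro j
    simp only [θ]
    split_ifs with hj
    · exact hj.choose_spec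
    · rfl
  have hθ : Function.Injective θ := fun j j' hj => β'.injective (by rw [← hκ, ← hκ, hj])
  have hθl : ∀ i j, β i = β' j → θ j = .inl i := by
    intro i j hij
    have hj : ∃ i, β i = β' j := ⟨i, hij⟩
    simp only [θ, dif_pos hj]
    exact congrArg _ (β.injective (hj.choose_spec.trans hij.symm))
  have hθr : ∀ j, (∀ i, β i ≠ β' j) → θ j = .inr j := by
    intro j hj
    simp only [θ]
    rw [dif_neg (by simpa using hj)]
  let β₀ : Fin r ↪ Fin r ⊕ Fin r := ⟨Sum.inl, Sum.inl_injective⟩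
  let β₀' : Fin r ↪ Fin r ⊕ Fin r := ⟨θ, hθ⟩
  -- The qubits outside both blocks are frozen at z₀, where φ does not vanish. On shared qubits the
  -- outer `extend` prevails, so their places in the second summand are dummies.
  let Φ : (Fin r ⊕ Fin r → Fin 2) → ℂ := fun y =>
    φ (Function.extend β (y ∘ Sum.inl) (Function.extend β' (y ∘ Sum.inr) z₀))
  have h0 : Φ = 0 := by
    refine h β₀ β₀' Φ ⟨fun h' => hc.1 ?_, ?_⟩ ?_ ?_
    · ext i
      rw [← hκ i]
      exact congrArg κ (DFunLike.congr_fun h' i)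
    · obtain ⟨i, j, hij⟩ := hc.2
      exact ⟨i, j, (hθl i j hij).symm⟩
    · intro ρ z
      refine Eq.trans (Finset.sum_congr rfl fun x _ => ?_)
        (hk ρ (Function.extend β' (z ∘ Sum.inr) z₀))
      have e1 : Function.extend β₀ x z ∘ Sum.inl = x := extend_comp_embedding β₀ x z
      have e2 : Function.extend β₀ x z ∘ Sum.inr = z ∘ Sum.inr := by
        ext j
        exact congrArg _ (extend_of_off (e := β₀) (fun i => by simp [β₀]) x z)
      simp only [Φ, e1, e2]
    · intro ρ z
      refine Eq.trans (Finset.sum_congr rfl fun x _ => ?_)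
        (hk' ρ (Function.extend β (z ∘ Sum.inl) z₀))
      simp only [Φ]
      congr 2
      ext q
      by_cases hq' : ∃ j, β' j = q
      · obtain ⟨j, rfl⟩ := hq'
        rw [β'.injective.extend_apply]
        by_cases hq : ∃ i, β i = β' j
        · obtain ⟨i, hi⟩ := hq
          rw [← hi, β.injective.extend_apply, Function.comp, ← hθl i j hi]
          exact congrArg _ (β₀'.injective.extend_apply _ _ j)
        · have hq : ∀ i, β i ≠ β' j := by simpa using hq
          rw [extend_of_off hq, β'.injective.extend_apply, Function.comp, ← hθr j hq]
          exact congrArg _ (β₀'.injective.extend_apply _ _ j)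
      · have hq' : ∀ j, β' j ≠ q := by simpa using hq'
        rw [extend_of_off hq']
        by_cases hq : ∃ i, β i = q
        · obtain ⟨i, rfl⟩ := hq
          rw [β.injective.extend_apply, β.injective.extend_apply]
          refine congrArg _ (extend_of_off (e := β₀') (fun j hj => hq' j ?_) x z)
          rw [← hκ j]
          exact congrArg κ hj
        · have hq : ∀ i, β i ≠ q := by simpa using hq
          rw [extend_of_off hq, extend_of_off hq, extend_of_off hq']
  refine hz₀ ?_
  have h1 := congrFun h0 (z₀ ∘ κ)
  have e1 : (z₀ ∘ κ) ∘ Sum.inl = z₀ ∘ β := rfl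
  have e2 : (z₀ ∘ κ) ∘ Sum.inr = z₀ ∘ β' := rfl
  simp only [Φ, e1, e2, extend_self] at h1
  exact h1

/-- Prescribing two of the r bits leaves 2^(r−2) patterns; this is the room in which the code will
be placed. -/
theorem card_patterns {i j : Fin r} (hij : i ≠ j) :
    Fintype.card {x : Fin r → Fin 2 // ¬ (x i = 0 ∧ x j = 1)} ≤ 2 ^ r - 2 ^ (r - 2) := by
  rw [Fintype.card_subtype_compl, Fintype.card_fun, Fintype.card_fin, Fintype.card_fin]
  refine Nat.sub_le_sub_left ?_ _
  have h1 : Fintype.card ({k : Fin r // k ≠ i ∧ k ≠ j} → Fin 2) = 2 ^ (r - 2) := by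
    rw [Fintype.card_fun, Fintype.card_fin]
    congr 1
    have : Fintype.card {k : Fin r // k ≠ i ∧ k ≠ j} = (({i, j} : Finset (Fin r))ᶜ).card := by
      rw [Fintype.card_subtype]
      congr 1
      ext k
      simp
    rw [this, Finset.card_compl, Finset.card_pair hij, Fintype.card_fin]
  rw [← h1]
  refine Fintype.card_le_of_injective (fun g => ⟨fun k => if h : k ≠ i ∧ k ≠ j then g ⟨k, h⟩ else
    if k = i then 0 else 1, by simp, by simp [hij.symm]⟩) fun g g' h => ?_
  ext ⟨k, hk⟩
  have := congrFun (Subtype.ext_iff.1 h) k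
  simp only [dif_pos hk] at this
  rw [this]

/-- Functionals that separate a given pair of conflicting blocks. -/
theorem exists_killedOn_imp_eq_zero {Q : Type*} (hM : 2 ^ r - 2 ^ (r - 2) ≤ M)
    (β β' : Fin r ↪ Q) (hc : Conflict β β') : ∃ B : Matrix (Fin M) (Fin r → Fin 2) ℂ,
      ∀ φ : (Q → Fin 2) → ℂ, KilledOn B β φ → KilledOn B β' φ → φ = 0 := by
  -- The M rows can enumerate all patterns other than 0 at i and 1 at j, with repetitions if M is
  -- larger.
  have enum : ∀ i j : Fin r, i ≠ j →
      ∃ g : Fin M → (Fin r → Fin 2), ∀ x, ¬ (x i = 0 ∧ x j = 1) → ∃ ρ, g ρ = x := by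
    intro i j hij
    have : Nonempty {x : Fin r → Fin 2 // ¬ (x i = 0 ∧ x j = 1)} := ⟨fun _ => 0, by simp⟩
    have hcard := (card_patterns hij).trans hM
    obtain ⟨e⟩ := Function.Embedding.nonempty_of_card_le
      (show Fintype.card {x : Fin r → Fin 2 // ¬ (x i = 0 ∧ x j = 1)} ≤ Fintype.card (Fin M) by
        simpa using hcard)
    refine ⟨fun ρ => (Function.invFun e ρ).1, fun x hx => ⟨e ⟨x, hx⟩, ?_⟩⟩
    simp only [Function.leftInverse_invFun e.injective _]
  by_cases hid : ∀ i j, β i = β' j → i = j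
  · obtain ⟨hne, i, i', hi⟩ := hc
    obtain rfl := hid i i' hi
    obtain ⟨k, hk⟩ : ∃ k, β k ≠ β' k := by
      by_contra! h
      exact hne (DFunLike.ext _ _ h)
    have hik : i ≠ k := by
      rintro rfl
      exact hk hi
    obtain ⟨g, hg⟩ := enum i k hik
    -- The kernel of B consists of states antisymmetric in the positions i and k. The shared qubit
    -- would thus form singlets with two different qubits.
    let B : Matrix (Fin M) (Fin r → Fin 2) ℂ := fun ρ x =>
      (if x = g ρ then 1 else 0) +
        if g ρ i ≠ g ρ k ∧ x = g ρ ∘ Equiv.swap i k then 1 else 0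
    have hB : ∀ (β : Fin r ↪ Q) φ, KilledOn B β φ → (∀ y, y (β i) = y (β k) → φ y = 0) ∧
        ∀ y, y (β i) = 1 → y (β k) = 0 →
          φ y + φ (Function.extend β ((y ∘ β) ∘ Equiv.swap i k) y) = 0 := by
      intro β φ h
      have eval : ∀ ρ z, ∑ x, B ρ x * φ (Function.extend β x z) =
          φ (Function.extend β (g ρ) z) + if g ρ i ≠ g ρ k then
            φ (Function.extend β (g ρ ∘ Equiv.swap i k) z) else 0 := by
        intro ρ z
        simp only [B, add_mul, Finset.sum_add_distrib, ite_mul, one_mul, zero_mul]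
        congr 1
        · simp
        · by_cases h' : g ρ i = g ρ k <;> simp [h']
      constructor
      · intro y hy
        obtain ⟨ρ, hρ⟩ := hg (y ∘ β) (by
          simp only [Function.comp, hy]
          rintro ⟨h1, h2⟩
          simp [h1] at h2)
        have := h ρ y
        rw [eval, hρ, extend_self] at this
        simpa [hy] using this
      · intro y hy hy'
        obtain ⟨ρ, hρ⟩ := hg (y ∘ β) (by simp [hy])
        have := h ρ y
        rw [eval, hρ, extend_self] at this
        simpa [hy, hy'] using this
    refine ⟨B, fun φ h h' => ?_⟩
    obtain ⟨h1, h2⟩ := hB β φ h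
    obtain ⟨h1', -⟩ := hB β' φ h'
    have hoff : ∀ l, β l ≠ β' k := fun l hl => hk (by rwa [hid l k hl] at hl)
    have fin2 : ∀ u v w : Fin 2, u ≠ v → u ≠ w → v = w := by decide
    ext y
    by_cases hy : y (β i) = y (β k)
    · exact h1 y hy
    by_cases hy' : y (β' i) = y (β' k)
    · exact h1' y hy'
    rw [← hi] at hy'
    have hab := fin2 _ _ _ hy hy'
    -- Only the case where both β k and β' k differ from the shared qubit remains. The swap within β
    -- changes the shared qubit but not β' k, so these now agree and φ y' = 0; antisymmetry on β
    -- then gives φ y = 0.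
    set y' := Function.extend β ((y ∘ β) ∘ Equiv.swap i k) y with hy'def
    have v1 : y' (β i) = y (β k) := by
      rw [hy'def, β.injective.extend_apply]; simp
    have v2 : y' (β k) = y (β i) := by
      rw [hy'def, β.injective.extend_apply]; simp
    have v3 : y' (β' k) = y (β' k) := extend_of_off hoff _ _
    have hz : φ y' = 0 := h1' y' (by rw [← hi, v1, v3, hab])
    rcases (by decide : ∀ u : Fin 2, u = 0 ∨ u = 1) (y (β i)) with h0 | h0
    · have hk1 : y (β k) = 1 := fin2 _ _ _ hy (by rw [h0]; decide)
      have := h2 y' (by rw [v1, hk1]) (by rw [v2, h0])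
      have hback : Function.extend β ((y' ∘ β) ∘ Equiv.swap i k) y' = y := by
        have e1 : (y' ∘ β) ∘ Equiv.swap i k = y ∘ β := by
          rw [hy'def, extend_comp_embedding]
          ext l
          simp
        rw [e1]
        exact AgreeOff.extend_eq fun l hl => (extend_of_off hl _ _).symm
      rw [hback, hz, zero_add] at this
      exact this
    · have hk0 : y (β k) = 0 := fin2 _ _ _ hy (by rw [h0]; decide)
      have := h2 y h0 hk0
      rw [← hy'def, hz, add_zero] at this
      exact this
  · push Not at hid
    obtain ⟨i, j, hij, hne⟩ := hid
    obtain ⟨g, hg⟩ := enum i j hne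
    -- B forces the value 0 at position i and 1 at position j. The shared qubit has position i in
    -- one block and j in the other.
    let B : Matrix (Fin M) (Fin r → Fin 2) ℂ := fun ρ x => if x = g ρ then 1 else 0
    have hB : ∀ (β : Fin r ↪ Q) φ y, KilledOn B β φ → φ y ≠ 0 → y (β i) = 0 ∧ y (β j) = 1 := by
      intro β φ y h hy
      by_contra hcon
      obtain ⟨ρ, hρ⟩ := hg (y ∘ β) hcon
      have := h ρ y
      simp only [B, ite_mul, one_mul, zero_mul, Finset.sum_ite_eq',
        Finset.mem_univ, if_true, hρ, extend_self] at this
      exact hy this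
    refine ⟨B, fun φ h h' => ?_⟩
    ext y
    by_contra hy
    have h1 := (hB β φ y h hy).1
    have h2 := (hB β' φ y h' hy).2
    rw [hij, h2] at h1
    simp at h1

/-- Generic functionals separate all conflicting blocks. -/
theorem exists_separating (hM : 2 ^ r - 2 ^ (r - 2) ≤ M) :
    ∃ B : Matrix (Fin M) (Fin r → Fin 2) ℂ, ∀ Q : Type, Separating B Q := by
  classical
  let Q := Fin r ⊕ Fin r
  -- The entries of B are the indeterminates, and the rows list the functionals of both blocks, so
  -- injectivity says that only φ = 0 is annihilated on both.
  let N : {p : (Fin r ↪ Q) × (Fin r ↪ Q) // Conflict p.1 p.2} →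
      Matrix (Bool × Fin M × (Q → Fin 2)) (Q → Fin 2)
        (MvPolynomial (Fin M × (Fin r → Fin 2)) ℂ) := fun p => Matrix.of fun a y =>
    ∑ x, if Function.extend (if a.1 then p.1.1 else p.1.2) x a.2.2 = y
      then MvPolynomial.X (a.2.1, x) else 0
  have eval : ∀ p (c : Fin M × (Fin r → Fin 2) → ℂ) (φ : (Q → Fin 2) → ℂ) a,
      ((N p).map (MvPolynomial.eval c) *ᵥ φ) a =
        ∑ x, c (a.2.1, x) * φ (Function.extend (if a.1 then p.1.1 else p.1.2) x a.2.2) := by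
    intro p c φ a
    simp only [mulVec, dotProduct, Matrix.map_apply, N, Matrix.of_apply, map_sum, Finset.sum_mul]
    rw [Finset.sum_comm]
    refine Finset.sum_congr rfl fun x _ => ?_
    simp only [apply_ite (MvPolynomial.eval c), MvPolynomial.eval_X, map_zero, ite_mul, zero_mul]
    exact (Finset.sum_eq_single _ (fun y _ hy => if_neg (Ne.symm hy)) (by simp)).trans (if_pos rfl)
  have inj : ∀ p (c : Fin M × (Fin r → Fin 2) → ℂ),
      Function.Injective ((N p).map (MvPolynomial.eval c)).mulVec ↔
      ∀ φ, KilledOn (fun ρ x => c (ρ, x)) p.1.1 φ → KilledOn (fun ρ x => c (ρ, x)) p.1.2 φ →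
        φ = 0 := by
    intro p c
    have : Function.Injective ((N p).map (MvPolynomial.eval c)).mulVec ↔
        ∀ φ, (N p).map (MvPolynomial.eval c) *ᵥ φ = 0 → φ = 0 :=
      injective_iff_map_eq_zero ((N p).map (MvPolynomial.eval c)).mulVecLin
    rw [this]
    refine forall_congr' fun φ => ?_
    rw [← and_imp]
    refine imp_congr_left ?_
    rw [funext_iff]
    simp only [eval]
    constructor
    · intro h
      exact ⟨fun ρ z => by simpa using h (true, ρ, z), fun ρ z => by simpa using h (false, ρ, z)⟩
    · rintro ⟨h1, h2⟩ ⟨b, ρ, z⟩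
      cases b
      · simpa using h2 ρ z
      · simpa using h1 ρ z
  obtain ⟨c, hc⟩ := exists_simultaneously_injective N fun p => by
    obtain ⟨B, hB⟩ := exists_killedOn_imp_eq_zero hM p.1.1 p.1.2 p.2
    exact ⟨fun q => B q.1 q.2, (inj p _).2 hB⟩
  exact ⟨fun ρ x => c (ρ, x), Separating.of_sum fun β δ φ h =>
    (inj ⟨(β, δ), h⟩ c).1 (hc ⟨(β, δ), h⟩) φ⟩

/-- A matrix with few rows annihilates an isometry. -/
theorem exists_isometry_mul_eq_zero {K : Type*} [Fintype K] [DecidableEq K] {d : ℕ}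
    (B : Matrix (Fin M) K ℂ) (h : M + d ≤ Fintype.card K) :
    ∃ V : Matrix K (Fin d) ℂ, Vᴴ * V = 1 ∧ B * V = 0 := by
  let f : EuclideanSpace ℂ K →ₗ[ℂ] (Fin M → ℂ) :=
    B.mulVecLin ∘ₗ (WithLp.linearEquiv 2 ℂ (K → ℂ)).toLinearMap
  -- The kernel of M functionals has dimension at least |K| − M ≥ d; the columns of V are d vectors
  -- of an orthonormal basis of it.
  have hdim : d ≤ Module.finrank ℂ (LinearMap.ker f) := by
    have h1 := LinearMap.finrank_range_add_finrank_ker f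
    have h2 := (LinearMap.range f).finrank_le
    simp only [finrank_euclideanSpace, Module.finrank_fin_fun] at h1 h2
    omega
  let b := stdOrthonormalBasis ℂ (LinearMap.ker f)
  let v : Fin d → EuclideanSpace ℂ K := fun a => (b (Fin.castLE hdim a)).1
  refine ⟨Matrix.of fun x a => v a x, ?_, ?_⟩
  · ext a a'
    have h1 := (orthonormal_iff_ite.1 b.orthonormal) (Fin.castLE hdim a) (Fin.castLE hdim a')
    rw [Submodule.coe_inner, PiLp.inner_apply] at h1
    rw [Matrix.mul_apply, Matrix.one_apply]
    simp only [conjTranspose_apply, Matrix.of_apply]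
    have e : (Fin.castLE hdim a = Fin.castLE hdim a') ↔ a = a' := (Fin.castLE_injective hdim).eq_iff
    simp only [e] at h1
    rw [← h1]
    refine Finset.sum_congr rfl fun x _ => ?_
    simp [v, mul_comm]
  · ext ρ a
    have h1 : f (v a) = 0 := (b (Fin.castLE hdim a)).2
    exact congrFun h1 ρ

end Generic

/-! ### Conflicting blocks and the decoding of consistent instances -/

theorem localOp_sub {ι J X : Type*} (H K : Matrix (ι → X) (ι → X) ℂ) (e : ι ↪ J) :
    localOp (H - K) e = localOp H e - localOp K e := by
  ext a b
  simp only [localOp, Matrix.sub_apply]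
  split_ifs <;> simp

namespace QCSP

variable {d r M : ℕ} {C : QCSP d} {V : Matrix (Fin r → Fin 2) (Fin d) ℂ} {hV : Vᴴ * V = 1}

/-- The block of qubits that encodes the qudit `p` of a clause. -/
def Placed.block {n : ℕ} (c : (C.encode V hV).Placed n) (p : Fin (C.arity c.type)) :
    Fin r ↪ Fin n :=
  ⟨fun i => c.args (finProdFinEquiv (p, i)), fun _ _ h =>
    (Prod.ext_iff.1 (finProdFinEquiv.injective (c.args.injective h))).2⟩

theorem Placed.eq_of_block_eq {n : ℕ} (c : (C.encode V hV).Placed n) {p p' : Fin (C.arity c.type)}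
    {i i' : Fin r} (h : c.block p i = c.block p' i') : p = p' :=
  (Prod.ext_iff.1 (finProdFinEquiv.injective (c.args.injective h))).1

/-- A state annihilated by an encoded clause is fixed by the complementary projector, which has V^⊗
as its left factor. Its slices along each block of the clause hence lie in the range of V, and B
annihilates this range. -/
theorem Placed.killedOn_block {B : Matrix (Fin M) (Fin r → Fin 2) ℂ} (hB : B * V = 0) {n : ℕ}
    (c : (C.encode V hV).Placed n) (p : Fin (C.arity c.type)) {φ : (Fin n → Fin 2) → ℂ}
    (h : c.op *ᵥ φ = 0) : KilledOn B (c.block p) φ := by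
  classical
  let m := C.arity c.type
  let A : Matrix (Fin m → Fin r → Fin 2) (Fin m → Fin d) ℂ := tensorMat fun _ => V
  let G : Matrix (Fin m → Fin d) (Fin m → Fin r → Fin 2) ℂ := (1 - C.clause c.type) * Aᴴ
  let e : Fin (m * r) ↪ Fin n := c.args
  let E : Matrix (Fin (m * r) → Fin 2) (Fin (m * r) → Fin 2) ℂ :=
    (A * G).submatrix (blockEquiv m r) (blockEquiv m r)
  have hφ : φ = localOp E e *ᵥ φ := by
    have h1 : c.op = 1 - localOp E e := by
      rw [← localOp_one e, ← localOp_sub, Placed.op, extendOp_eq_localOp]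
      congr 1
      change (1 - A * (1 - C.clause c.type) * Aᴴ).submatrix (blockEquiv m r) (blockEquiv m r) = _
      rw [Matrix.mul_assoc, submatrix_sub]
      simp [E, G]
    rw [h1, sub_mulVec, one_mulVec, sub_eq_zero] at h
    exact h
  intro ρ z
  have hagree : ∀ x y, AgreeOff e (Function.extend (c.block p) x z) y ↔ AgreeOff e z y := by
    intro x y
    refine forall_congr' fun j => forall_congr' fun hj => ?_
    rw [extend_of_off (e := c.block p) fun i => hj _]
  have hblk : ∀ x, blockEquiv m r (Function.extend (c.block p) x z ∘ e) =
      Function.update (blockEquiv m r (z ∘ e)) p x := by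
    intro x
    ext p' i : 2
    by_cases hp : p' = p
    · subst hp
      rw [Function.update_self]
      exact (c.block p').injective.extend_apply x z i
    · rw [Function.update_of_ne hp]
      exact extend_of_off (fun i' hi' => hp (c.eq_of_block_eq hi').symm) x z
  have hA : ∀ a, ∑ x, B ρ x * A (Function.update (blockEquiv m r (z ∘ e)) p x) a = 0 := by
    intro a
    have h0 : ∑ x, B ρ x * V x (a p) = 0 := by
      have := congrFun (congrFun hB ρ) (a p)
      rwa [Matrix.mul_apply] at this
    have h1 : ∀ x, A (Function.update (blockEquiv m r (z ∘ e)) p x) a = V x (a p) *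
        ∏ p' ∈ Finset.univ.erase p, V (blockEquiv m r (z ∘ e) p') (a p') := by
      intro x
      simp only [A, tensorMat]
      rw [← Finset.mul_prod_erase _ _ (Finset.mem_univ p), Function.update_self]
      congr 1
      refine Finset.prod_congr rfl fun p' hp' => ?_
      rw [Function.update_of_ne (Finset.ne_of_mem_erase hp')]
    simp only [h1, ← mul_assoc]
    rw [← Finset.sum_mul, h0, zero_mul]
  have hE : ∀ y, ∑ x, B ρ x * localOp E e (Function.extend (c.block p) x z) y = 0 := by
    intro y
    by_cases hy : AgreeOff e z y
    · have h1 : ∀ x, localOp E e (Function.extend (c.block p) x z) y =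
          ∑ a, A (Function.update (blockEquiv m r (z ∘ e)) p x) a *
            G a (blockEquiv m r (y ∘ e)) := by
        intro x
        rw [localOp, if_pos ((hagree x y).2 hy)]
        simp only [E, submatrix_apply]
        rw [hblk, Matrix.mul_apply]
      simp only [h1, Finset.mul_sum, ← mul_assoc]
      rw [Finset.sum_comm]
      refine Finset.sum_eq_zero fun a _ => ?_
      rw [← Finset.sum_mul, hA, zero_mul]
    · refine Finset.sum_eq_zero fun x _ => ?_
      rw [localOp, if_neg fun h' => hy ((hagree x y).1 h'), mul_zero]
  rw [hφ]
  simp only [mulVec, dotProduct, Finset.mul_sum, ← mul_assoc]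
  rw [Finset.sum_comm]
  refine Finset.sum_eq_zero fun y _ => ?_
  rw [← Finset.sum_mul, hE, zero_mul]

/-- No two blocks of qubits that occur in the instance are in conflict. -/
def Instance.Consistent (I : (C.encode V hV).Instance) : Prop :=
  ∀ c ∈ I.clauses, ∀ c' ∈ I.clauses, ∀ p p', ¬ Conflict (c.block p) (c'.block p')

theorem Instance.Satisfiable.consistent {B : Matrix (Fin M) (Fin r → Fin 2) ℂ} (hB : B * V = 0)
    (hS : ∀ Q : Type, Separating B Q) {I : (C.encode V hV).Instance} (h : I.Satisfiable) :
    I.Consistent := by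
  obtain ⟨φ, hφ, hk⟩ := h
  exact fun c hc c' hc' p p' hcon => hφ (hS _ _ _ φ hcon (c.killedOn_block hB p (hk c hc))
    (c'.killedOn_block hB p' (hk c' hc')))

variable [NeZero r]

/-- The clause on qudits that are numbered by the first qubits of their blocks. -/
def Placed.decode {n : ℕ} (c : (C.encode V hV).Placed n) : C.Placed n :=
  ⟨c.type, ⟨fun p => c.block p 0, fun _ _ h => c.eq_of_block_eq h⟩⟩

/-- The instance on qudits that are numbered by the first qubits of their blocks. -/
def Instance.decode (I : (C.encode V hV).Instance) : C.Instance :=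
  ⟨I.n, I.clauses.map Placed.decode⟩

/-- Without conflicts, blocks that share a qubit coincide, so a block is determined by its first
qubit. The first qubits serve as sites, with the other qubits of a block read off from any clause
that contains it. -/
theorem Instance.Consistent.exists_sites {I : (C.encode V hV).Instance} (h : I.Consistent) :
    ∃ (J : Type) (_ : Fintype J) (_ : DecidableEq J) (α : J ↪ Fin I.n) (β : J × Fin r ↪ Fin I.n)
      (L : List (C.SiteClause J)), I = ⟨I.n, L.map (SiteClause.toQubits hV β)⟩ ∧
        I.decode = ⟨I.n, L.map (SiteClause.toQudits α)⟩ := by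
  classical
  have heq : ∀ c ∈ I.clauses, ∀ c' ∈ I.clauses, ∀ p p' i i', c.block p i = c'.block p' i' →
      c.block p = c'.block p' := by
    intro c hc c' hc' p p' i i' hi
    by_contra hne
    exact h c hc c' hc' p p' ⟨hne, i, i', hi⟩
  let J := {q : Fin I.n // ∃ c ∈ I.clauses, ∃ p, Placed.block c p 0 = q}
  choose γ hγ π hπ using fun q : J => q.2
  let β : J × Fin r ↪ Fin I.n := ⟨fun a => (γ a.1).block (π a.1) a.2, by
    rintro ⟨q, i⟩ ⟨q', i'⟩ hq
    have h1 := heq _ (hγ q) _ (hγ q') _ _ _ _ hq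
    have h2 : q = q' := by
      apply Subtype.ext
      rw [← hπ q, ← hπ q', h1]
    subst h2
    simpa using hq⟩
  let toSite : {c // c ∈ I.clauses} → C.SiteClause J := fun c =>
    ⟨c.1.type, ⟨fun p => ⟨c.1.block p 0, c.1, c.2, p, rfl⟩, fun p p' hp =>
      c.1.eq_of_block_eq (Subtype.ext_iff.1 hp)⟩⟩
  refine ⟨J, inferInstance, inferInstance, ⟨Subtype.val, Subtype.val_injective⟩, β,
    I.clauses.attach.map toSite, ?_, ?_⟩
  · have : ∀ c, (toSite c).toQubits hV β = c.1 := by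
      rintro ⟨⟨t, a⟩, hc⟩
      simp only [SiteClause.toQubits, toSite]
      congr 1
      ext x
      obtain ⟨⟨p, i⟩, rfl⟩ := finProdFinEquiv.surjective x
      set q : J := ⟨Placed.block (⟨t, a⟩ : (C.encode V hV).Placed I.n) p 0, _, hc, p, rfl⟩
      have h1 := heq _ (hγ q) _ hc _ p 0 0 (hπ q)
      have h2 := DFunLike.congr_fun h1 i
      refine Eq.trans ?_ (congrArg Fin.val h2)
      simp only [Function.Embedding.trans_apply, Equiv.coe_toEmbedding, Equiv.symm_apply_apply]
      rfl
    have e : SiteClause.toQubits hV β ∘ toSite = Subtype.val := funext this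
    rw [List.map_map, e, List.attach_map_subtype_val]
  · rw [List.map_map, Instance.decode]
    congr 1
    conv_lhs => rw [← List.attach_map_subtype_val I.clauses, List.map_map]
    rfl

end QCSP

/-! ### Reading and writing encodings of instances -/

theorem List.getD_flatMap_of_length {α β : Type*} (l : List α) (f : α → List β) {m : ℕ}
    (hf : ∀ x, (f x).length = m) (b : β) (k : ℕ) {u : ℕ} (hu : u < m) :
    (l.flatMap f).getD (k * m + u) b = (l[k]?.map fun x => (f x).getD u b).getD b := by
  induction l generalizing k with
  | nil => simp
  | cons a l ih =>
    rw [List.flatMap_cons]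
    cases k with
    | zero => rw [List.getD_append _ _ _ _ (by rw [hf]; omega)]; simp
    | succ k =>
      rw [List.getD_append_right _ _ _ _ (by rw [hf]; nlinarith), hf,
        show (k + 1) * m + u - m = k * m + u by rw [Nat.succ_mul]; omega, ih]
      simp

namespace QCSP

theorem length_bits (w a : ℕ) : (bits w a).length = w := by simp [bits]

theorem getD_bits {w t : ℕ} (a : ℕ) (ht : t < w) : (bits w a).getD t false = a.testBit t := by
  simp [bits, List.getD, ht]

/-- The bit `j` of the encoding with width `w` of an instance with `c` clauses, where `o q t` is
the bit `t` of its integer number `q`. -/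
def EncBit (w c : ℕ) (o : ℕ → ℕ → Prop) (j : ℕ) : Prop :=
  j < w ∨ (w < j ∧ j < w + 1 + c) ∨
    -- For w = 0 there are no digits, and the condition 0 < w rules out the division by zero.
    (w + c + 2 ≤ j ∧ 0 < w ∧ o ((j - (w + c + 2)) / w) ((j - (w + c + 2)) % w))

/-- The bit `t` of the integer number `q` in the encoding `s`. -/
def ReadBit (s : List Bool) (w c q t : ℕ) : Prop := s.getD (w + c + 2 + q * w + t) false = true

/-- The two unary integers in front of `s` are `w` and `c`. -/
def Header (s : List Bool) (w c : ℕ) : Prop :=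
  (∀ j < w, s.getD j false = true) ∧ ¬ s.getD w false = true ∧
    (∀ j < c, s.getD (w + 1 + j) false = true) ∧ ¬ s.getD (w + 1 + c) false = true

theorem Header.unique {s : List Bool} {w c x y : ℕ} (h : Header s w c) (h' : Header s x y) :
    w = x ∧ c = y := by
  obtain ⟨h1, h2, h3, h4⟩ := h
  obtain ⟨g1, g2, g3, g4⟩ := h'
  have hw : w = x := by
    rcases lt_trichotomy w x with h | h | h
    · exact absurd (g1 w h) h2
    · exact h
    · exact absurd (h1 x h) g2
  subst hw
  refine ⟨rfl, ?_⟩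
  rcases lt_trichotomy c y with h | h | h
  · exact absurd (g3 c h) h4
  · exact h
  · exact absurd (h3 y h) g4

/-- The string `s` has the header `w`, `c`, and its integers of width `w` are `v 0`, `v 1`, … -/
structure Reads (s : List Bool) (w c : ℕ) (v : ℕ → ℕ) : Prop where
  header : Header s w c
  width_le : w ≤ s.length
  count_le : c ≤ s.length
  lt_pow : ∀ q, v q < 2 ^ w
  bit_iff : ∀ q, ∀ t < w, ReadBit s w c q t ↔ (v q).testBit t = true

/-- The encoding of width `w` without padding. -/
def encodeString (w c : ℕ) (l : List ℕ) : List Bool :=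
  List.replicate w true ++ [false] ++ List.replicate c true ++ [false] ++ l.flatMap (bits w)

theorem length_encodeString (w c : ℕ) (l : List ℕ) :
    (encodeString w c l).length = w + c + 2 + w * l.length := by
  have : (l.flatMap (bits w)).length = w * l.length := by
    rw [List.length_flatMap]
    simp [length_bits, mul_comm]
  simp only [encodeString, List.length_append, List.length_replicate, List.length_singleton, this]
  omega

theorem getD_flatMap_bits (w : ℕ) (l : List ℕ) (q : ℕ) {t : ℕ} (ht : t < w) :
    (l.flatMap (bits w)).getD (q * w + t) false = (l.getD q 0).testBit t := by
  rw [List.getD_flatMap_of_length l _ (length_bits w) _ _ ht]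
  simp only [getD_bits _ ht]
  rw [List.getD]
  cases l[q]? <;> simp

theorem getD_encodeString (w c : ℕ) (l : List ℕ) (j : ℕ) :
    (encodeString w c l).getD j false = true ↔
      EncBit w c (fun q t => (l.getD q 0).testBit t = true) j := by
  have hp : (List.replicate w true ++ [false] ++ List.replicate c true ++ [false]).length =
      w + c + 2 := by simp; omega
  rw [encodeString, EncBit]
  by_cases hj : j < w + c + 2
  · rw [List.getD_append _ _ _ _ (by rw [hp]; exact hj)]
    have : ¬ w + c + 2 ≤ j := by omega
    simp only [this, false_and, or_false]
    simp only [List.getD, List.getElem?_append, List.length_append, List.length_replicate,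
      List.length_singleton, List.getElem?_replicate]
    grind
  · rw [List.getD_append_right _ _ _ _ (by rw [hp]; omega), hp]
    have h1 : ¬ j < w := by omega
    have h2 : ¬ j < w + 1 + c := by omega
    simp only [h1, h2, and_false, false_or, show w + c + 2 ≤ j by omega, true_and]
    rcases Nat.eq_zero_or_pos w with rfl | hw
    · have : l.flatMap (bits 0) = [] := by simp [bits]
      simp [this]
    · have := getD_flatMap_bits w l ((j - (w + c + 2)) / w) (Nat.mod_lt (j - (w + c + 2)) hw)
      rw [Nat.div_add_mod'] at this
      rw [this]
      simp only [hw, true_and]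

variable {d : ℕ} {C : QCSP d}

theorem Instance.encodes_iff (s : List Bool) (I : C.Instance) :
    I.Encodes s ↔ ∃ w pad : ℕ, (∀ a ∈ I.ints, a < 2 ^ w) ∧
      s = encodeString w I.clauses.length I.ints ++ List.replicate pad false := Iff.rfl

theorem getD_append_replicate_false (l : List Bool) (pad j : ℕ) :
    (l ++ List.replicate pad false).getD j false = l.getD j false := by
  by_cases h : j < l.length
  · rw [List.getD_append _ _ _ _ h]
  · rw [List.getD_append_right _ _ _ _ (by omega), List.getD_eq_default l _ (by omega)]
    simp only [List.getD, List.getElem?_replicate]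
    split_ifs <;> rfl

theorem Instance.Encodes.exists_reads {s : List Bool} {I : C.Instance} (h : I.Encodes s) :
    ∃ w, Reads s w I.clauses.length (fun q => I.ints.getD q 0) := by
  obtain ⟨w, pad, hw, rfl⟩ := (I.encodes_iff s).1 h
  refine ⟨w, ⟨⟨?_, ?_, ?_, ?_⟩, ?_, ?_, ?_, ?_⟩⟩
  · intro j hj
    rw [getD_append_replicate_false, getD_encodeString]
    exact Or.inl hj
  · rw [getD_append_replicate_false, getD_encodeString]
    simp only [EncBit]; omega
  · intro j hj
    rw [getD_append_replicate_false, getD_encodeString]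
    exact Or.inr (Or.inl (by omega))
  · rw [getD_append_replicate_false, getD_encodeString]
    simp only [EncBit]; omega
  · rw [List.length_append, length_encodeString]; omega
  · rw [List.length_append, length_encodeString]; omega
  · intro q
    by_cases hq : q < I.ints.length
    · rw [List.getD_eq_getElem _ _ hq]
      exact hw _ (List.getElem_mem hq)
    · rw [List.getD_eq_default _ _ (by omega)]
      positivity
  · intro q t ht
    rw [ReadBit, getD_append_replicate_false, getD_encodeString, EncBit]
    have e : w + I.clauses.length + 2 + q * w + t - (w + I.clauses.length + 2) = t + q * w := by
      omega
    rw [e, Nat.add_mul_div_right _ _ (by omega), Nat.add_mul_mod_self_right,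
      Nat.div_eq_of_lt ht, Nat.mod_eq_of_lt ht, zero_add]
    have h1 : ¬ w + I.clauses.length + 2 + q * w + t < w := by omega
    have h2 : ¬ w + I.clauses.length + 2 + q * w + t < w + 1 + I.clauses.length := by omega
    have h3 : w + I.clauses.length + 2 ≤ w + I.clauses.length + 2 + q * w + t := by omega
    have h4 : 0 < w := by omega
    simp only [h1, h2, h3, h4, true_and, and_false, false_or]

-- Past the last integer `getD` returns 0, so `EncBit` is false there and any surplus length is
-- padding.
open Classical in
theorem Instance.encodes_ofFn {I : C.Instance} {w ℓ : ℕ} {P : ℕ → Prop}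
    (hw : ∀ a ∈ I.ints, a < 2 ^ w)
    (hℓ : w + I.clauses.length + 2 + w * I.ints.length ≤ ℓ)
    (hP : ∀ j, P j ↔ EncBit w I.clauses.length (fun q t => (I.ints.getD q 0).testBit t = true) j) :
    I.Encodes (List.ofFn fun j : Fin ℓ => decide (P j)) := by
  rw [Instance.encodes_iff]
  refine ⟨w, ℓ - (w + I.clauses.length + 2 + w * I.ints.length), hw, ?_⟩
  refine List.ext_getElem (by simp [length_encodeString]; omega) fun j h1 h2 => ?_
  rw [List.getElem_ofFn, ← List.getD_eq_getElem _ false h2, getD_append_replicate_false,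
    Bool.eq_iff_iff, getD_encodeString, decide_eq_true_eq, hP]

theorem Placed.length_ints {n : ℕ} (c : C.Placed n) : c.ints.length = 1 + C.maxArity := by
  have : C.arity c.type ≤ C.maxArity := Finset.le_sup (f := C.arity) (Finset.mem_univ _)
  simp [Placed.ints]
  omega

theorem Instance.length_ints (I : C.Instance) :
    I.ints.length = 1 + I.clauses.length * (1 + C.maxArity) := by
  rw [Instance.ints, List.length_cons, List.length_flatMap]
  simp [Placed.length_ints, add_comm]

/-- The argument `p` of a clause, or `0` if there is none. -/
def Placed.argD {n : ℕ} (c : C.Placed n) (p : ℕ) : ℕ :=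
  if h : p < C.arity c.type then c.args ⟨p, h⟩ else 0

theorem Placed.getD_ints_succ {n : ℕ} (c : C.Placed n) (p : ℕ) :
    c.ints.getD (p + 1) 0 = c.argD p := by
  rw [Placed.ints, List.getD_cons_succ, Placed.argD]
  split_ifs with h
  · rw [List.getD_append _ _ _ _ (by simpa using h), List.getD_eq_getElem _ _ (by simpa using h)]
    simp
  · rw [List.getD_append_right _ _ _ _ (by simpa using h)]
    simp only [List.getD, List.getElem?_replicate]
    split_ifs <;> rfl

theorem Instance.getD_ints_type (I : C.Instance) (k : ℕ) :
    I.ints.getD (k * (1 + C.maxArity) + 1) 0 =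
      (I.clauses[k]?.map fun c => (c.type : ℕ)).getD 0 := by
  rw [Instance.ints, List.getD_cons_succ]
  have := List.getD_flatMap_of_length I.clauses Placed.ints Placed.length_ints 0 k
    (u := 0) (by omega)
  rw [add_zero] at this
  rw [this]
  rfl

theorem Instance.getD_ints_arg (I : C.Instance) (k : ℕ) {p : ℕ} (hp : p < C.maxArity) :
    I.ints.getD (k * (1 + C.maxArity) + (p + 1) + 1) 0 =
      (I.clauses[k]?.map fun c => c.argD p).getD 0 := by
  rw [Instance.ints, List.getD_cons_succ,
    List.getD_flatMap_of_length I.clauses Placed.ints Placed.length_ints 0 k (by omega)]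
  simp only [Placed.getD_ints_succ]

end QCSP

/-! ### Constant-depth tests on encoded instances -/

namespace QCSP

variable {d : ℕ}

theorem eq_of_testBit_lt {a b w : ℕ} (ha : a < 2 ^ w) (hb : b < 2 ^ w)
    (h : ∀ u < w, (a.testBit u = true ↔ b.testBit u = true)) : a = b := by
  refine Nat.eq_of_testBit_eq fun u => ?_
  by_cases hu : u < w
  · exact Bool.eq_iff_iff.2 (h u hu)
  · have hp : 2 ^ w ≤ 2 ^ u := Nat.pow_le_pow_right (by omega) (by omega)
    rw [Nat.testBit_lt_two_pow (ha.trans_le hp), Nat.testBit_lt_two_pow (hb.trans_le hp)]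

/-- The arity of the clause type number `τ`, or `0` if there is none. -/
def arityD (C : QCSP d) (τ : ℕ) : ℕ := if h : τ < C.numTypes then C.arity ⟨τ, h⟩ else 0

theorem arityD_type (C : QCSP d) {t : Fin C.numTypes} : C.arityD t = C.arity t := by
  simp [arityD]

/-- The integers number `p` and `q` in `s` are equal. -/
def SameInt (s : List Bool) (w c p q : ℕ) : Prop :=
  ∀ u < s.length, u < w → (ReadBit s w c p u ↔ ReadBit s w c q u)

/-- The clause number `k` of the encoding `s`, in which each clause takes `1 + A` integers, has an
argument number `p`. -/
def HasArg (C : QCSP d) (A : ℕ) (s : List Bool) (w c k p : ℕ) : Prop :=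
  -- Only w digits are compared, hence τ < 2 ^ w. Past the last clause the digits are zeros and
  -- would pass for type 0, hence k < c.
  ∃ τ < C.numTypes, (τ < 2 ^ w ∧ p < C.arityD τ ∧ k < c) ∧
    ∀ u < s.length, u < w → (ReadBit s w c (k * (1 + A) + 1) u ↔ τ.testBit u = true)

theorem Reads.sameInt_iff {s : List Bool} {w c : ℕ} {v : ℕ → ℕ} (h : Reads s w c v) (q q' : ℕ) :
    SameInt s w c q q' ↔ v q = v q' := by
  constructor
  · intro hs
    refine eq_of_testBit_lt (h.lt_pow q) (h.lt_pow q') fun u hu => ?_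
    rw [← h.bit_iff q u hu, ← h.bit_iff q' u hu]
    exact hs u (hu.trans_le h.width_le) hu
  · intro he u _ hu
    rw [h.bit_iff q u hu, h.bit_iff q' u hu, he]

theorem Reads.hasArg_iff (C : QCSP d) {A : ℕ} {s : List Bool} {w c : ℕ} {v : ℕ → ℕ}
    (h : Reads s w c v) (k p : ℕ) :
    HasArg C A s w c k p ↔ k < c ∧ p < C.arityD (v (k * (1 + A) + 1)) := by
  constructor
  · rintro ⟨τ, -, ⟨h1, h2, h3⟩, h4⟩
    refine ⟨h3, ?_⟩
    rwa [eq_of_testBit_lt (h.lt_pow _) h1 fun u hu => ?_]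
    rw [← h.bit_iff _ u hu]
    exact h4 u (hu.trans_le h.width_le) hu
  · rintro ⟨h1, h2⟩
    refine ⟨_, ?_, ⟨h.lt_pow _, h2, h1⟩, fun u _ hu => h.bit_iff _ u hu⟩
    by_contra h3
    rw [arityD, dif_neg h3] at h2
    omega

section Circuits

variable {α : Type*}

theorem ac0Rel_readBit (w c q t : α → ℕ) :
    AC0Rel fun a s => ReadBit s (w a) (c a) (q a) (t a) := AC0Rel.bit _

theorem ac0Rel_sameInt (w c q q' : α → ℕ) :
    AC0Rel fun a s => SameInt s (w a) (c a) (q a) (q' a) := by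
  have h : AC0Rel fun (a : α × ℕ) s => a.2 < w a.1 →
      (ReadBit s (w a.1) (c a.1) (q a.1) a.2 ↔ ReadBit s (w a.1) (c a.1) (q' a.1) a.2) :=
    (AC0Rel.const _).imp ((ac0Rel_readBit _ _ _ _).iff (ac0Rel_readBit _ _ _ _))
  exact h.forall_lt (fun _ N => N) 1 fun _ N => by simp

/-- This makes a constant T an admissible bound for the quantifiers. -/
theorem le_add_two_pow (T N : ℕ) : T ≤ (N + 2) ^ T :=
  Nat.lt_two_pow_self.le.trans (Nat.pow_le_pow_left (by omega) _)

theorem ac0Rel_hasArg (C : QCSP d) (A : ℕ) (w c k p : α → ℕ) :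
    AC0Rel fun a s => HasArg C A s (w a) (c a) (k a) (p a) := by
  have h : AC0Rel fun (b : (α × ℕ) × ℕ) s => b.2 < w b.1.1 →
      (ReadBit s (w b.1.1) (c b.1.1) (k b.1.1 * (1 + A) + 1) b.2 ↔ b.1.2.testBit b.2 = true) :=
    (AC0Rel.const _).imp ((ac0Rel_readBit _ _ _ _).iff (AC0Rel.const _))
  have h' := h.forall_lt (fun _ N => N) 1 fun _ N => by simp
  exact ((AC0Rel.const fun b : α × ℕ => b.2 < 2 ^ w b.1 ∧ p b.1 < C.arityD b.2 ∧
    k b.1 < c b.1).and h').exists_lt (fun _ _ => C.numTypes) C.numTypes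
      fun _ N => le_add_two_pow _ N

theorem ac0Rel_encBit (w c j : α → ℕ) {o : α → ℕ → ℕ → List Bool → Prop}
    (h : ∀ q t : α → ℕ, AC0Rel fun a s => o a (q a) (t a) s) :
    AC0Rel fun a s => EncBit (w a) (c a) (fun q t => o a q t s) (j a) :=
  (AC0Rel.const _).or ((AC0Rel.const _).or ((AC0Rel.const _).and ((AC0Rel.const _).and (h _ _))))

theorem ac0Rel_header (w c : α → ℕ) :
    AC0Rel fun a s => (w a ≤ s.length ∧ c a ≤ s.length) ∧ Header s (w a) (c a) := by
  have h1 : AC0Rel fun (a : α × ℕ) s => a.2 < w a.1 → s.getD a.2 false = true :=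
    (AC0Rel.const _).imp (AC0Rel.bit _)
  have h2 : AC0Rel fun (a : α × ℕ) s => a.2 < c a.1 → s.getD (w a.1 + 1 + a.2) false = true :=
    (AC0Rel.const _).imp (AC0Rel.bit _)
  have h1' := h1.forall_lt (fun _ N => N) 1 fun _ N => by simp
  have h2' := h2.forall_lt (fun _ N => N) 1 fun _ N => by simp
  refine ((AC0Rel.ofLength fun a N => w a ≤ N ∧ c a ≤ N).and
    (h1'.and ((AC0Rel.bit w).not.and
      (h2'.and (AC0Rel.bit fun a => w a + 1 + c a).not)))).congr fun a s => ?_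
  -- The circuits quantify up to the input length; the bounds on w and c make this the same as
  -- quantifying up to w and c.
  refine and_congr_right fun hle => and_congr ?_
    (and_congr_right fun _ => and_congr_left fun _ => ?_)
  · exact ⟨fun h j _ hj => h j hj, fun h j hj => h j (hj.trans_le hle.1) hj⟩
  · exact ⟨fun h j _ hj => h j hj, fun h j hj => h j (hj.trans_le hle.2) hj⟩

/-- The output bit `j`, given by `out w c j` once the header `w`, `c` has been read. -/
def AfterHeader (out : ℕ → ℕ → ℕ → List Bool → Prop) (j : ℕ) (s : List Bool) : Prop :=
  ∃ w < s.length + 1, ∃ c < s.length + 1,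
    ((w ≤ s.length ∧ c ≤ s.length) ∧ Header s w c) ∧ out w c j s

theorem ac0Rel_afterHeader {out : ℕ → ℕ → ℕ → List Bool → Prop}
    (h : AC0Rel fun (a : (ℕ × ℕ) × ℕ) s => out a.1.2 a.2 a.1.1 s) : AC0Rel (AfterHeader out) := by
  have h1 : AC0Rel fun (a : (ℕ × ℕ) × ℕ) s =>
      ((a.1.2 ≤ s.length ∧ a.2 ≤ s.length) ∧ Header s a.1.2 a.2) ∧ out a.1.2 a.2 a.1.1 s :=
    (ac0Rel_header (fun a : (ℕ × ℕ) × ℕ => a.1.2) fun a => a.2).and h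
  exact (h1.exists_lt (fun _ N => N + 1) 1 fun _ N => by simp).exists_lt
    (fun _ N => N + 1) 1 fun _ N => by simp

theorem Reads.afterHeader_iff {out : ℕ → ℕ → ℕ → List Bool → Prop} {s : List Bool} {w c : ℕ}
    {v : ℕ → ℕ} (h : Reads s w c v) (j : ℕ) : AfterHeader out j s ↔ out w c j s := by
  constructor
  · rintro ⟨w', -, c', -, ⟨-, hh⟩, ho⟩
    obtain ⟨rfl, rfl⟩ := hh.unique h.header
    exact ho
  · exact fun ho => ⟨w, Nat.lt_succ_of_le h.width_le, c, Nat.lt_succ_of_le h.count_le,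
      ⟨⟨h.width_le, h.count_le⟩, h.header⟩, ho⟩

end Circuits

theorem encBit_congr {w c j : ℕ} {o o' : ℕ → ℕ → Prop} (h : ∀ q, ∀ t < w, (o q t ↔ o' q t)) :
    EncBit w c o j ↔ EncBit w c o' j := by
  refine or_congr_right (or_congr_right (and_congr_right fun _ => and_congr_right fun hw => ?_))
  exact h _ _ (Nat.mod_lt _ hw)

/-! ### From qudits to qubits -/

section Encoding

variable {C : QCSP d} {ρ : ℕ} {V : Matrix (Fin (2 ^ ρ) → Fin 2) (Fin d) ℂ}

/-- A clause on qudits as a clause on abstract sites. -/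
def Placed.toSite {n : ℕ} (c : C.Placed n) : C.SiteClause (Fin n) := ⟨c.type, c.args⟩

/-- The instance on qubits in which the qudit `a` becomes the block of the qubits `2 ^ ρ * a + i`. -/
def Instance.encode (hV : Vᴴ * V = 1) (I : C.Instance) : (C.encode V hV).Instance :=
  ⟨I.n * 2 ^ ρ, (I.clauses.map Placed.toSite).map
    (SiteClause.toQubits hV finProdFinEquiv.toEmbedding)⟩

theorem Instance.map_toSite_toQudits (I : C.Instance) :
    (⟨I.n, (I.clauses.map Placed.toSite).map
      (SiteClause.toQudits (Function.Embedding.refl _))⟩ : C.Instance) = I := by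
  have : (fun c : C.Placed I.n => c.toSite.toQudits (Function.Embedding.refl _)) = id := rfl
  rw [List.map_map]
  change (⟨I.n, I.clauses.map fun c => c.toSite.toQudits (Function.Embedding.refl _)⟩ :
    C.Instance) = I
  rw [this, List.map_id]

theorem Instance.satisfiable_encode_iff [NeZero d] (hV : Vᴴ * V = 1) (I : C.Instance) :
    (I.encode hV).Satisfiable ↔ I.Satisfiable := by
  conv_rhs => rw [← I.map_toSite_toQudits]
  exact satisfiable_toQubits_iff hV _ _ _

theorem Instance.EnergyAtLeast.encode [NeZero d] (hV : Vᴴ * V = 1) {I : C.Instance} {b : ℝ}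
    (h : I.EnergyAtLeast b) : (I.encode hV).EnergyAtLeast (min b 1) := by
  rw [← I.map_toSite_toQudits] at h
  exact energyAtLeast_toQubits hV _ _ _ h

/-- The offset in the block is added only to genuine arguments, since the padding of a clause must
remain 0. The output bits therefore depend on the test `HasArg`. -/
theorem Placed.argD_encode (hV : Vᴴ * V = 1) {n : ℕ} (c : C.Placed n) (p : ℕ) :
    (c.toSite.toQubits hV finProdFinEquiv.toEmbedding).argD p =
      2 ^ ρ * c.argD (p / 2 ^ ρ) + if p / 2 ^ ρ < C.arity c.type then p % 2 ^ ρ else 0 := by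
  have key : p < C.arity c.type * 2 ^ ρ ↔ p / 2 ^ ρ < C.arity c.type :=
    (Nat.div_lt_iff_lt_mul (by positivity)).symm
  by_cases h : p / 2 ^ ρ < C.arity c.type
  · have h' : p < (C.encode V hV).arity (c.toSite.toQubits hV finProdFinEquiv.toEmbedding).type :=
      key.2 h
    rw [Placed.argD, Placed.argD, dif_pos h', dif_pos h, if_pos h, add_comm]
    rfl
  · have h' : ¬ p < (C.encode V hV).arity (c.toSite.toQubits hV finProdFinEquiv.toEmbedding).type :=
      fun h' => h (key.1 h')
    rw [Placed.argD, Placed.argD, dif_neg h', dif_neg h, if_neg h]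
    rfl

/-- After the number of qudits come records of 1 + `C.maxArity` * 2 ^ ρ integers; quotient and
remainder of q − 1 give the clause and the place in its record. -/
theorem Instance.getD_ints_encode (hV : Vᴴ * V = 1) (I : C.Instance) (q : ℕ) :
    (I.encode hV).ints.getD q 0 =
      if q = 0 then 2 ^ ρ * I.ints.getD 0 0
      else if (q - 1) % (1 + C.maxArity * 2 ^ ρ) = 0 then
        I.ints.getD ((q - 1) / (1 + C.maxArity * 2 ^ ρ) * (1 + C.maxArity) + 1) 0
      else 2 ^ ρ * I.ints.getD ((q - 1) / (1 + C.maxArity * 2 ^ ρ) * (1 + C.maxArity) +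
          (((q - 1) % (1 + C.maxArity * 2 ^ ρ) - 1) / 2 ^ ρ + 1) + 1) 0 +
        if (q - 1) / (1 + C.maxArity * 2 ^ ρ) < I.clauses.length ∧
          ((q - 1) % (1 + C.maxArity * 2 ^ ρ) - 1) / 2 ^ ρ < C.arityD (I.ints.getD
            ((q - 1) / (1 + C.maxArity * 2 ^ ρ) * (1 + C.maxArity) + 1) 0)
        then ((q - 1) % (1 + C.maxArity * 2 ^ ρ) - 1) % 2 ^ ρ else 0 := by
  have hA := C.encode_maxArity V hV
  have hcl : ∀ k : ℕ, (I.encode hV).clauses[k]? = I.clauses[k]?.map fun c =>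
      c.toSite.toQubits hV finProdFinEquiv.toEmbedding := by
    intro k
    have e : (I.encode hV).clauses = I.clauses.map fun c =>
      c.toSite.toQubits hV finProdFinEquiv.toEmbedding := List.map_map
    exact (congrArg (fun l : List _ => l[k]?) e).trans List.getElem?_map
  rcases q with _ | q
  · simp [Instance.ints, Instance.encode, mul_comm]
  simp only [Nat.add_sub_cancel, Nat.succ_ne_zero, if_false]
  have hq := Nat.div_add_mod' q (1 + C.maxArity * 2 ^ ρ)
  have hlt := Nat.mod_lt q (show 0 < 1 + C.maxArity * 2 ^ ρ by omega)
  generalize q / (1 + C.maxArity * 2 ^ ρ) = k at hq ⊢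
  generalize q % (1 + C.maxArity * 2 ^ ρ) = u at hq hlt ⊢
  subst hq
  rcases u with _ | p
  · have := (I.encode hV).getD_ints_type k
    rw [hA] at this
    rw [if_pos rfl, add_zero, this, I.getD_ints_type]
    refine (congrArg (fun o => (Option.map (fun c => (c.type : ℕ)) o).getD 0) (hcl k)).trans ?_
    rcases I.clauses[k]? with _ | c <;> rfl
  · have hp : p < C.maxArity * 2 ^ ρ := by omega
    have := (I.encode hV).getD_ints_arg k (p := p) (by rw [hA]; exact hp)
    rw [hA] at this
    rw [if_neg (by omega), this, Nat.add_sub_cancel, I.getD_ints_type,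
      I.getD_ints_arg k (p := p / 2 ^ ρ) ((Nat.div_lt_iff_lt_mul (by positivity)).2 hp)]
    refine (congrArg (fun o => (Option.map (fun c => c.argD p) o).getD 0) (hcl k)).trans ?_
    rcases hk : I.clauses[k]? with _ | c
    · have := not_lt.2 (List.getElem?_eq_none_iff.1 hk)
      simp only [this, false_and, if_false]
      rfl
    · obtain ⟨hk, -⟩ := List.getElem?_eq_some_iff.1 hk
      simp only [Option.map_some, Option.getD_some, hk, true_and, arityD_type]
      exact c.argD_encode hV p

/-- The bit `t` of the integer number `q` of the encoding on qubits. -/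
def EncodedBit (C : QCSP d) (ρ w c q t : ℕ) (s : List Bool) : Prop :=
  -- Multiplication by 2 ^ ρ shifts the digits by ρ, and the output width is w + ρ.
  (q = 0 ∧ ρ ≤ t ∧ ReadBit s w c 0 (t - ρ)) ∨
  -- Types are not shifted; from t = w on, `ReadBit` would run into the next integer, so these
  -- digits are set to zero.
  ((q ≠ 0 ∧ (q - 1) % (1 + C.maxArity * 2 ^ ρ) = 0 ∧ t < w) ∧
    ReadBit s w c ((q - 1) / (1 + C.maxArity * 2 ^ ρ) * (1 + C.maxArity) + 1) t) ∨
  ((q ≠ 0 ∧ (q - 1) % (1 + C.maxArity * 2 ^ ρ) ≠ 0 ∧ ρ ≤ t) ∧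
    ReadBit s w c ((q - 1) / (1 + C.maxArity * 2 ^ ρ) * (1 + C.maxArity) +
      (((q - 1) % (1 + C.maxArity * 2 ^ ρ) - 1) / 2 ^ ρ + 1) + 1) (t - ρ)) ∨
  -- The ρ low digits, freed by the shift, hold the offset in the block.
  ((q ≠ 0 ∧ (q - 1) % (1 + C.maxArity * 2 ^ ρ) ≠ 0 ∧ t < ρ ∧
    (((q - 1) % (1 + C.maxArity * 2 ^ ρ) - 1) % 2 ^ ρ).testBit t = true) ∧
    HasArg C C.maxArity s w c ((q - 1) / (1 + C.maxArity * 2 ^ ρ))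
      (((q - 1) % (1 + C.maxArity * 2 ^ ρ) - 1) / 2 ^ ρ))

theorem ac0Rel_encodedBit {α : Type*} (C : QCSP d) (ρ : ℕ) (w c q t : α → ℕ) :
    AC0Rel fun a s => EncodedBit C ρ (w a) (c a) (q a) (t a) s :=
  ((AC0Rel.const _).and ((AC0Rel.const _).and (ac0Rel_readBit _ _ _ _))).or
    (((AC0Rel.const _).and (ac0Rel_readBit _ _ _ _)).or
      (((AC0Rel.const _).and (ac0Rel_readBit _ _ _ _)).or
        ((AC0Rel.const _).and (ac0Rel_hasArg _ _ _ _ _ _))))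

theorem Reads.encodedBit_iff (hV : Vᴴ * V = 1) {I : C.Instance} {s : List Bool} {w : ℕ}
    (h : Reads s w I.clauses.length fun q => I.ints.getD q 0) (q : ℕ) {t : ℕ} (ht : t < w + ρ) :
    EncodedBit C ρ w I.clauses.length q t s ↔
      ((I.encode hV).ints.getD q 0).testBit t = true := by
  rw [Instance.getD_ints_encode, EncodedBit, h.hasArg_iff]
  rcases q with _ | q
  · have e : 2 ^ ρ * I.ints.getD 0 0 = 2 ^ ρ * I.ints.getD 0 0 + 0 := rfl
    rw [if_pos rfl, e, Nat.testBit_two_pow_mul_add _ (by positivity)]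
    by_cases hρ : ρ ≤ t
    · simp only [hρ, if_neg (not_lt.2 hρ), h.bit_iff 0 (t - ρ) (by omega)]
      simp
    · simp [hρ]
  simp only [Nat.add_sub_cancel, Nat.succ_ne_zero, if_false, ne_eq, not_false_eq_true, true_and,
    false_and, false_or]
  generalize hk : q / (1 + C.maxArity * 2 ^ ρ) = k
  generalize hu : q % (1 + C.maxArity * 2 ^ ρ) = u
  by_cases hu0 : u = 0
  · simp only [hu0, not_true_eq_false, false_and, or_false, true_and, if_true]
    by_cases htw : t < w
    · simp only [htw, true_and, h.bit_iff _ t htw]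
    · have := (h.lt_pow (k * (1 + C.maxArity) + 1)).trans_le
        (Nat.pow_le_pow_right (show 0 < 2 by omega) (not_lt.1 htw))
      rw [Nat.testBit_lt_two_pow this]
      simp [htw]
  · simp only [hu0, not_false_eq_true, true_and, false_and, false_or, if_false]
    have hmod : (u - 1) % 2 ^ ρ < 2 ^ ρ := Nat.mod_lt _ (by positivity)
    rw [Nat.testBit_two_pow_mul_add _ (by split_ifs <;> omega)]
    by_cases hρ : ρ ≤ t
    · simp only [hρ, not_lt.2 hρ, if_false, true_and, false_and, or_false,
        h.bit_iff _ (t - ρ) (show t - ρ < w by omega)]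
    · simp only [hρ, false_and, false_or, not_le.1 hρ, true_and, if_true]
      split_ifs with hc
      · simp only [hc.1, hc.2]; simp
      · rw [Nat.zero_testBit]
        exact ⟨fun h' => absurd h'.2 hc, fun h' => absurd h' (by simp)⟩

theorem Reads.encode_ints_lt (hV : Vᴴ * V = 1) {I : C.Instance} {s : List Bool} {w : ℕ}
    (h : Reads s w I.clauses.length fun q => I.ints.getD q 0) :
    ∀ a ∈ (I.encode hV).ints, a < 2 ^ (w + ρ) := by
  intro a ha
  obtain ⟨q, hq, rfl⟩ := List.getElem_of_mem ha
  have hmul : ∀ x y, x < 2 ^ w → y < 2 ^ ρ → 2 ^ ρ * x + y < 2 ^ (w + ρ) := by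
    intro x y hx hy
    rw [pow_add]
    nlinarith
  have hpos : 0 < 2 ^ ρ := by positivity
  rw [← List.getD_eq_getElem _ 0 hq, Instance.getD_ints_encode]
  split_ifs
  · exact hmul _ 0 (h.lt_pow _) hpos
  · exact (h.lt_pow _).trans_le (Nat.pow_le_pow_right (by omega) (by omega))
  · exact hmul _ _ (h.lt_pow _) (Nat.mod_lt _ hpos)
  · exact hmul _ 0 (h.lt_pow _) hpos

/-- The output length of the reduction to qubits. -/
noncomputable def encodeLength (A ρ : ℕ) : Polynomial ℕ :=
  (.X + .C ρ) + .X + 2 + (.X + .C ρ) * (1 + .X * (1 + .C (A * 2 ^ ρ)))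

open Classical in
/-- The reduction to qubits on bit strings. -/
noncomputable def encodeMap (C : QCSP d) (ρ : ℕ) (s : List Bool) : List Bool :=
  List.ofFn fun j : Fin ((encodeLength C.maxArity ρ).eval s.length) =>
    decide (AfterHeader (fun w c j s => EncBit (w + ρ) c (fun q t => EncodedBit C ρ w c q t s) j)
      j s)

theorem isAC0_encodeMap (C : QCSP d) (ρ : ℕ) : IsAC0 (encodeMap C ρ) :=
  (ac0Rel_afterHeader (ac0Rel_encBit _ _ _ fun _ _ => ac0Rel_encodedBit _ _ _ _ _ _)).isAC0 _

theorem Instance.Encodes.encodeMap (hV : Vᴴ * V = 1) {I : C.Instance} {s : List Bool}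
    (h : I.Encodes s) : (I.encode hV).Encodes (QCSP.encodeMap C ρ s) := by
  obtain ⟨w, hr⟩ := h.exists_reads
  have hlen : (I.encode hV).clauses.length = I.clauses.length := by simp [Instance.encode]
  unfold QCSP.encodeMap
  refine Instance.encodes_ofFn (P := fun j => AfterHeader (fun w c j s =>
    EncBit (w + ρ) c (fun q t => EncodedBit C ρ w c q t s) j) j s) (hr.encode_ints_lt hV) ?_
      fun j => ?_
  · rw [Instance.length_ints, hlen, C.encode_maxArity V hV]
    have h1 := hr.width_le
    have h2 := hr.count_le
    simp only [encodeLength, Polynomial.eval_add, Polynomial.eval_mul, Polynomial.eval_X,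
      Polynomial.eval_C, Polynomial.eval_one, Polynomial.eval_ofNat]
    gcongr
  · rw [hr.afterHeader_iff, hlen]
    exact encBit_congr fun q t ht => hr.encodedBit_iff hV q ht

end Encoding

end QCSP

namespace QCSP

variable {d r : ℕ}

/-! ### From qubits to qudits -/

section Decoding

variable {C : QCSP d} {V : Matrix (Fin r → Fin 2) (Fin d) ℂ} {hV : Vᴴ * V = 1}

theorem Placed.argD_block {n : ℕ} (c : (C.encode V hV).Placed n) (p : Fin (C.arity c.type))
    (i : Fin r) : c.argD (p * r + i) = c.block p i := by
  have h : (finProdFinEquiv (p, i) : ℕ) = p * r + i := by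
    rw [finProdFinEquiv_apply_val]
    ring
  have h' : (p * r + i : ℕ) < (C.encode V hV).arity c.type := by
    rw [← h]
    exact (finProdFinEquiv (p, i)).2
  rw [Placed.argD, dif_pos h']
  exact congrArg (fun x => (c.args x : ℕ)) (Fin.ext h.symm)

theorem Instance.length_decode [NeZero r] (I : (C.encode V hV).Instance) :
    I.decode.clauses.length = I.clauses.length := by simp [Instance.decode]

theorem Placed.argD_decode [NeZero r] {n : ℕ} (c : (C.encode V hV).Placed n) (p : ℕ) :
    c.decode.argD p = c.argD (p * r) := by
  by_cases h : p < C.arity c.type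
  · have := c.argD_block ⟨p, h⟩ 0
    rw [Fin.val_zero, add_zero] at this
    exact (dif_pos h).trans this.symm
  · have h' : ¬ p * r < (C.encode V hV).arity c.type :=
      not_lt.2 (Nat.mul_le_mul_right r (not_lt.1 h))
    rw [Placed.argD.eq_def c, dif_neg h']
    exact dif_neg h

/-- As qudits are numbered by first qubits and n is kept, every output integer is a copy of an input
integer, with the same width. -/
theorem Instance.getD_ints_decode [NeZero r] (I : (C.encode V hV).Instance) (q : ℕ) :
    I.decode.ints.getD q 0 = I.ints.getD (if q = 0 then 0
      else if (q - 1) % (1 + C.maxArity) = 0 then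
        (q - 1) / (1 + C.maxArity) * (1 + C.maxArity * r) + 1
      else (q - 1) / (1 + C.maxArity) * (1 + C.maxArity * r) +
        (((q - 1) % (1 + C.maxArity) - 1) * r + 1) + 1) 0 := by
  have hA := C.encode_maxArity V hV
  have hcl : ∀ k : ℕ, I.decode.clauses[k]? = I.clauses[k]?.map Placed.decode :=
    fun k => List.getElem?_map
  rcases q with _ | q
  · rfl
  simp only [Nat.add_sub_cancel, Nat.succ_ne_zero, if_false]
  have hq := Nat.div_add_mod' q (1 + C.maxArity)
  have hlt := Nat.mod_lt q (show 0 < 1 + C.maxArity by omega)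
  generalize q / (1 + C.maxArity) = k at hq ⊢
  generalize q % (1 + C.maxArity) = u at hq hlt ⊢
  subst hq
  rcases u with _ | p
  · have := I.getD_ints_type k
    rw [hA] at this
    rw [if_pos rfl, add_zero, this, I.decode.getD_ints_type]
    refine (congrArg (fun o => (Option.map (fun c => (c.type : ℕ)) o).getD 0) (hcl k)).trans ?_
    rcases I.clauses[k]? with _ | c <;> rfl
  · have hp : p < C.maxArity := by omega
    have := I.getD_ints_arg k (p := p * r) (by
      rw [hA]; exact Nat.mul_lt_mul_of_pos_right hp (NeZero.pos r))
    rw [hA] at this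
    rw [if_neg (by omega), Nat.add_sub_cancel, this, I.decode.getD_ints_arg k hp]
    refine (congrArg (fun o => (Option.map (fun c => c.argD p) o).getD 0) (hcl k)).trans ?_
    rcases I.clauses[k]? with _ | c
    · rfl
    · exact c.argD_decode p

/-- In the encoding `s` of an instance on qubits, two blocks are in conflict. -/
def HasConflict (C : QCSP d) (r : ℕ) (s : List Bool) (w c : ℕ) : Prop :=
  ∃ k < s.length, ∃ k' < s.length, ∃ p < C.maxArity, ∃ p' < C.maxArity, ∃ i < r, ∃ i' < r,
    -- The records have the length of those of the encoded QCSP, but p and p' count blocks. The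
    -- blocks share a qubit, at positions i and i', and differ at some common position i''.
    (HasArg C (C.maxArity * r) s w c k p ∧ HasArg C (C.maxArity * r) s w c k' p' ∧
      SameInt s w c (k * (1 + C.maxArity * r) + (p * r + i + 1) + 1)
        (k' * (1 + C.maxArity * r) + (p' * r + i' + 1) + 1)) ∧
    ∃ i'' < r, ¬ SameInt s w c (k * (1 + C.maxArity * r) + (p * r + i'' + 1) + 1)
      (k' * (1 + C.maxArity * r) + (p' * r + i'' + 1) + 1)

theorem ac0Rel_hasConflict {α : Type*} (C : QCSP d) (r : ℕ) (w c : α → ℕ) :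
    AC0Rel fun a s => HasConflict C r s (w a) (c a) := by
  have h1 := (ac0Rel_sameInt (α := ((((((α × ℕ) × ℕ) × ℕ) × ℕ) × ℕ) × ℕ) × ℕ)
    (fun a => w a.1.1.1.1.1.1.1) (fun a => c a.1.1.1.1.1.1.1)
    (fun a => a.1.1.1.1.1.1.2 * (1 + C.maxArity * r) + (a.1.1.1.1.2 * r + a.2 + 1) + 1)
    (fun a => a.1.1.1.1.1.2 * (1 + C.maxArity * r) + (a.1.1.1.2 * r + a.2 + 1) + 1)).not.exists_lt
      (fun _ _ => r) r fun _ N => le_add_two_pow _ N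
  have h2 := (ac0Rel_hasArg (α := (((((α × ℕ) × ℕ) × ℕ) × ℕ) × ℕ) × ℕ) C (C.maxArity * r)
    (fun a => w a.1.1.1.1.1.1) (fun a => c a.1.1.1.1.1.1) (fun a => a.1.1.1.1.1.2)
    (fun a => a.1.1.1.2)).and ((ac0Rel_hasArg C (C.maxArity * r)
      (fun a => w a.1.1.1.1.1.1) (fun a => c a.1.1.1.1.1.1) (fun a => a.1.1.1.1.2)
      (fun a => a.1.1.2)).and (ac0Rel_sameInt (fun a => w a.1.1.1.1.1.1)
        (fun a => c a.1.1.1.1.1.1)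
        (fun a => a.1.1.1.1.1.2 * (1 + C.maxArity * r) + (a.1.1.1.2 * r + a.1.2 + 1) + 1)
        (fun a => a.1.1.1.1.2 * (1 + C.maxArity * r) + (a.1.1.2 * r + a.2 + 1) + 1)))
  have hN : ∀ N : ℕ, N ≤ (N + 2) ^ 1 := fun N => by simp
  exact ((((((h2.and h1).exists_lt (fun _ _ => r) r fun _ N => le_add_two_pow _ N).exists_lt
    (fun _ _ => r) r fun _ N => le_add_two_pow _ N).exists_lt
    (fun _ _ => C.maxArity) C.maxArity fun _ N => le_add_two_pow _ N).exists_lt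
    (fun _ _ => C.maxArity) C.maxArity fun _ N => le_add_two_pow _ N).exists_lt
    (fun _ N => N) 1 fun _ N => hN N).exists_lt (fun _ N => N) 1 fun _ N => hN N

theorem Reads.hasConflict_iff {I : (C.encode V hV).Instance} {s : List Bool} {w : ℕ}
    (h : Reads s w I.clauses.length fun q => I.ints.getD q 0) :
    HasConflict C r s w I.clauses.length ↔ ¬ I.Consistent := by
  have hA := C.encode_maxArity V hV
  have htype : ∀ k (hk : k < I.clauses.length),
      I.ints.getD (k * (1 + C.maxArity * r) + 1) 0 = I.clauses[k].type := by
    intro k hk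
    have := I.getD_ints_type k
    rw [hA] at this
    rw [this, List.getElem?_eq_getElem hk]
    rfl
  have harg : ∀ k (hk : k < I.clauses.length) (p : Fin (C.arity I.clauses[k].type)) (i : Fin r),
      I.ints.getD (k * (1 + C.maxArity * r) + (p * r + i + 1) + 1) 0 = I.clauses[k].block p i := by
    intro k hk p i
    have hp : (p : ℕ) < C.maxArity := p.2.trans_le (Finset.le_sup (f := C.arity) (Finset.mem_univ _))
    have hpi : (p * r + i : ℕ) < C.maxArity * r := by
      have := i.2
      nlinarith
    have := I.getD_ints_arg k (p := p * r + i) (by rw [hA]; exact hpi)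
    rw [hA] at this
    rw [this, List.getElem?_eq_getElem hk, ← Placed.argD_block]
    rfl
  have hhas : ∀ k p, HasArg C (C.maxArity * r) s w I.clauses.length k p ↔
      ∃ hk : k < I.clauses.length, p < C.arity I.clauses[k].type := by
    intro k p
    rw [h.hasArg_iff, ← exists_prop]
    refine exists_congr fun hk => ?_
    rw [htype k hk]
    exact iff_of_eq (congrArg (p < ·) C.arityD_type)
  constructor
  · rintro ⟨k, -, k', -, p, -, p', -, i, hi, i', hi', ⟨h1, h2, h3⟩, i'', hi'', h4⟩ hcons
    obtain ⟨hk, hp⟩ := (hhas k p).1 h1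
    obtain ⟨hk', hp'⟩ := (hhas k' p').1 h2
    rw [h.sameInt_iff, harg k hk ⟨p, hp⟩ ⟨i, hi⟩, harg k' hk' ⟨p', hp'⟩ ⟨i', hi'⟩] at h3
    rw [h.sameInt_iff, harg k hk ⟨p, hp⟩ ⟨i'', hi''⟩, harg k' hk' ⟨p', hp'⟩ ⟨i'', hi''⟩] at h4
    exact hcons _ (List.getElem_mem hk) _ (List.getElem_mem hk') ⟨p, hp⟩ ⟨p', hp'⟩
      ⟨fun he => h4 (by rw [he]), _, _, Fin.ext h3⟩
  · intro hcons
    simp only [Instance.Consistent, not_forall, not_not] at hcons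
    obtain ⟨c, hc, c', hc', p, p', hne, i, i', hi⟩ := hcons
    obtain ⟨k, hk, rfl⟩ := List.getElem_of_mem hc
    obtain ⟨k', hk', rfl⟩ := List.getElem_of_mem hc'
    have hle : ∀ t, C.arity t ≤ C.maxArity := fun t =>
      Finset.le_sup (f := C.arity) (Finset.mem_univ t)
    refine ⟨k, hk.trans_le h.count_le, k', hk'.trans_le h.count_le, p, p.2.trans_le (hle _),
      p', p'.2.trans_le (hle _), i, i.2, i', i'.2, ⟨(hhas _ _).2 ⟨hk, p.2⟩,
        (hhas _ _).2 ⟨hk', p'.2⟩, ?_⟩, ?_⟩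
    · rw [h.sameInt_iff, harg k hk p i, harg k' hk' p' i', hi]
    · obtain ⟨i'', hi''⟩ : ∃ i'', I.clauses[k].block p i'' ≠ I.clauses[k'].block p' i'' := by
        by_contra! hall
        exact hne (DFunLike.ext _ _ hall)
      refine ⟨i'', i''.2, ?_⟩
      rw [h.sameInt_iff, harg k hk p i'', harg k' hk' p' i'']
      exact fun he => hi'' (Fin.ext he)

/-- The bit `t` of the integer number `q` of the encoding on qudits. -/
def DecodedBit (C : QCSP d) (r w c q t : ℕ) (s : List Bool) : Prop :=
  ReadBit s w c (if q = 0 then 0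
      else if (q - 1) % (1 + C.maxArity) = 0 then
        (q - 1) / (1 + C.maxArity) * (1 + C.maxArity * r) + 1
      else (q - 1) / (1 + C.maxArity) * (1 + C.maxArity * r) +
        (((q - 1) % (1 + C.maxArity) - 1) * r + 1) + 1) t

/-- The output bit `j` of the reduction to qudits, which is the fixed bit `Z j` if there is a
conflict. -/
def DecodeOut (C : QCSP d) (r : ℕ) (Z : ℕ → Prop) (w c j : ℕ) (s : List Bool) : Prop :=
  (HasConflict C r s w c ∧ Z j) ∨
    (¬ HasConflict C r s w c ∧ EncBit w c (fun q t => DecodedBit C r w c q t s) j)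

/-- The output length of the reduction to qudits. -/
noncomputable def decodeLength (A ℓ₀ : ℕ) : Polynomial ℕ :=
  (.X + .X + 2 + .X * (1 + .X * (1 + .C A))) + .C ℓ₀

open Classical in
/-- The reduction to qudits on bit strings. -/
noncomputable def decodeMap (C : QCSP d) (r : ℕ) (Z : ℕ → Prop) (ℓ₀ : ℕ) (s : List Bool) :
    List Bool :=
  List.ofFn fun j : Fin ((decodeLength C.maxArity ℓ₀).eval s.length) =>
    decide (AfterHeader (DecodeOut C r Z) j s)

theorem isAC0_decodeMap (C : QCSP d) (r : ℕ) (Z : ℕ → Prop) (ℓ₀ : ℕ) :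
    IsAC0 (decodeMap C r Z ℓ₀) :=
  (ac0Rel_afterHeader (((ac0Rel_hasConflict C r _ _).and (AC0Rel.const _)).or
    ((ac0Rel_hasConflict C r _ _).not.and
      (ac0Rel_encBit _ _ _ fun _ _ => ac0Rel_readBit _ _ _ _)))).isAC0 _

theorem Instance.Encodes.decodeMap_of_consistent [NeZero r] {I : (C.encode V hV).Instance}
    {s : List Bool} (h : I.Encodes s) (hI : I.Consistent) (Z : ℕ → Prop) (ℓ₀ : ℕ) :
    I.decode.Encodes (decodeMap C r Z ℓ₀ s) := by
  obtain ⟨w, hr⟩ := h.exists_reads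
  refine Instance.encodes_ofFn (P := fun j => AfterHeader (DecodeOut C r Z) j s) (w := w) ?_ ?_
    fun j => ?_
  · intro a ha
    obtain ⟨q, hq, rfl⟩ := List.getElem_of_mem ha
    rw [← List.getD_eq_getElem _ 0 hq, Instance.getD_ints_decode]
    exact hr.lt_pow _
  · rw [Instance.length_ints, I.length_decode]
    have h1 := hr.width_le
    have h2 := hr.count_le
    simp only [decodeLength, Polynomial.eval_add, Polynomial.eval_mul, Polynomial.eval_X,
      Polynomial.eval_C, Polynomial.eval_one, Polynomial.eval_ofNat]
    refine le_trans ?_ (Nat.le_add_right _ _)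
    gcongr
  · rw [hr.afterHeader_iff, I.length_decode, DecodeOut, hr.hasConflict_iff]
    simp only [hI, not_true_eq_false, false_and, false_or, not_false_eq_true, true_and]
    refine encBit_congr fun q t ht => ?_
    rw [Instance.getD_ints_decode]
    exact hr.bit_iff _ t ht

/-- The encoding of I₀ is hard-wired into the circuits as Z; its length is a summand of
`decodeLength`, so it fits at every input length. -/
theorem Instance.Encodes.decodeMap_of_not_consistent {I : (C.encode V hV).Instance}
    {s : List Bool} (h : I.Encodes s) (hI : ¬ I.Consistent) {I₀ : C.Instance} {w₀ : ℕ}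
    (hw₀ : ∀ a ∈ I₀.ints, a < 2 ^ w₀) :
    I₀.Encodes (decodeMap C r
      (EncBit w₀ I₀.clauses.length fun q t => (I₀.ints.getD q 0).testBit t = true)
      (w₀ + I₀.clauses.length + 2 + w₀ * I₀.ints.length) s) := by
  obtain ⟨w, hr⟩ := h.exists_reads
  refine Instance.encodes_ofFn (P := fun j => AfterHeader (DecodeOut C r _) j s) hw₀ ?_
    fun j => ?_
  · simp only [decodeLength, Polynomial.eval_add, Polynomial.eval_C]
    exact Nat.le_add_left _ _
  · rw [hr.afterHeader_iff, DecodeOut, hr.hasConflict_iff]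
    simp only [hI, not_false_eq_true, true_and, not_true_eq_false, false_and, or_false]

theorem Instance.Consistent.satisfiable_decode_iff [NeZero d] [NeZero r]
    {I : (C.encode V hV).Instance} (h : I.Consistent) : I.decode.Satisfiable ↔ I.Satisfiable := by
  obtain ⟨J, _, _, α, β, L, h1, h2⟩ := h.exists_sites
  rw [h2]
  conv_rhs => rw [h1]
  exact (satisfiable_toQubits_iff hV α β L).symm

theorem Instance.Consistent.energyAtLeast_decode [NeZero d] [NeZero r]
    {I : (C.encode V hV).Instance} (h : I.Consistent) {b : ℝ} (hb : I.EnergyAtLeast b) :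
    I.decode.EnergyAtLeast b := by
  obtain ⟨J, _, _, α, β, L, h1, h2⟩ := h.exists_sites
  rw [h2]
  rw [h1] at hb
  exact energyAtLeast_toQudits hV α β L hb

end Decoding

/-! ### The reductions -/

theorem _root_.Polynomial.eval_nat_mono (p : Polynomial ℕ) {m n : ℕ} (h : m ≤ n) :
    p.eval m ≤ p.eval n := by
  rw [Polynomial.eval_eq_sum_range, Polynomial.eval_eq_sum_range]
  gcongr

theorem _root_.InversePolyBounded.pos {b : ℕ → ℝ} (h : InversePolyBounded b) (n : ℕ) : 0 < b n := by
  obtain ⟨p, hp⟩ := h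
  exact lt_of_lt_of_le (by positivity) (hp n)

theorem Instance.EnergyAtLeast.mono {C : QCSP d} {I : C.Instance} {b c : ℝ}
    (h : I.EnergyAtLeast b) (hc : c ≤ b) : I.EnergyAtLeast c :=
  BoundedBelow.mono h hc

theorem encode_reducesVia [NeZero d] {ρ : ℕ} (C : QCSP d)
    {V : Matrix (Fin (2 ^ ρ) → Fin 2) (Fin d) ℂ} (hV : Vᴴ * V = 1) :
    C.ReducesVia (C.encode V hV) (encodeMap C ρ) := by
  refine ⟨⟨?_, ?_⟩, fun b ⟨p, hp⟩ => ⟨fun n => 1 / (((p.eval n : ℕ) : ℝ) + 1),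
    ⟨p, fun n => le_rfl⟩, ?_, ?_⟩⟩
  · rintro s ⟨I, hI, hs⟩
    exact ⟨I.encode hV, hI.encodeMap hV, (I.satisfiable_encode_iff hV).2 hs⟩
  · rintro s ⟨I, hI, hs⟩
    exact ⟨I.encode hV, hI.encodeMap hV, fun h => hs ((I.satisfiable_encode_iff hV).1 h)⟩
  · rintro s ⟨I, hI, hs⟩
    exact ⟨I.encode hV, hI.encodeMap hV, (I.satisfiable_encode_iff hV).2 hs⟩
  · rintro s ⟨I, hI, hs⟩
    -- With natural coefficients p is monotone, and the encoded instance has at least as many qubits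
    -- as there were qudits; so 1/(p + 1) at the new size is below both b and 1.
    refine ⟨I.encode hV, hI.encodeMap hV, (hs.encode hV).mono (le_min ?_ ?_)⟩
    · refine le_trans ?_ (hp I.n)
      have : p.eval I.n ≤ p.eval (I.encode hV).n :=
        p.eval_nat_mono (Nat.le_mul_of_pos_right _ (by positivity))
      dsimp only
      gcongr
    · rw [div_le_one (by positivity)]
      simp

/-- Satisfiable instances have no conflicts, so only unsatisfiable ones are sent to I₀. The energy
of I₀ is at least a constant ε > 0, and adding m ≥ 1/ε to the polynomial brings the promised gap
below ε. -/
theorem exists_decode_reducesVia [NeZero d] [NeZero r] {M : ℕ} (C : QCSP d)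
    {V : Matrix (Fin r → Fin 2) (Fin d) ℂ} (hV : Vᴴ * V = 1)
    {B : Matrix (Fin M) (Fin r → Fin 2) ℂ} (hB : B * V = 0) (hS : ∀ Q : Type, Separating B Q)
    {I₀ : C.Instance} (h₀ : ¬ I₀.Satisfiable) :
    ∃ g, IsAC0 g ∧ (C.encode V hV).ReducesVia C g := by
  obtain ⟨ε, hε, hE⟩ := Instance.exists_energyAtLeast h₀
  have hw₀ : ∀ a ∈ I₀.ints, a < 2 ^ I₀.ints.sum := fun a ha =>
    (List.le_sum_of_mem ha).trans_lt Nat.lt_two_pow_self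
  obtain ⟨m, hm⟩ := exists_nat_ge (1 / ε)
  obtain ⟨Z, ℓ₀, hZ⟩ : ∃ Z ℓ₀, ∀ (I : (C.encode V hV).Instance) s, I.Encodes s →
      ¬ I.Consistent → I₀.Encodes (decodeMap C r Z ℓ₀ s) :=
    ⟨_, _, fun I s hI hc => hI.decodeMap_of_not_consistent hc hw₀⟩
  have sat : ∀ s, (∃ I : (C.encode V hV).Instance, I.Encodes s ∧ I.Satisfiable) →
      ∃ I : C.Instance, I.Encodes (decodeMap C r Z ℓ₀ s) ∧ I.Satisfiable := by
    rintro s ⟨I, hI, hs⟩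
    have hc := hs.consistent hB hS
    exact ⟨I.decode, hI.decodeMap_of_consistent hc _ _, hc.satisfiable_decode_iff.2 hs⟩
  refine ⟨decodeMap C r Z ℓ₀, isAC0_decodeMap C r Z ℓ₀, ⟨sat, ?_⟩, ?_⟩
  · rintro s ⟨I, hI, hs⟩
    by_cases hc : I.Consistent
    · exact ⟨I.decode, hI.decodeMap_of_consistent hc _ _,
        fun h => hs (hc.satisfiable_decode_iff.1 h)⟩
    · exact ⟨I₀, hZ I s hI hc, h₀⟩
  · rintro b ⟨p, hp⟩
    obtain ⟨P, hP⟩ : ∃ P : Polynomial ℕ, ∀ n, P.eval n = p.eval n + m :=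
      ⟨p + Polynomial.C m, fun n => by simp⟩
    refine ⟨fun n => 1 / (((P.eval n : ℕ) : ℝ) + 1), ⟨P, fun n => le_rfl⟩, sat, ?_⟩
    rintro s ⟨I, hI, hs⟩
    by_cases hc : I.Consistent
    · refine ⟨I.decode, hI.decodeMap_of_consistent hc _ _, (hc.energyAtLeast_decode hs).mono ?_⟩
      refine le_trans ?_ (hp I.n)
      have e : I.decode.n = I.n := rfl
      simp only [e, hP]
      gcongr
      simp
    · refine ⟨I₀, hZ I s hI hc, hE.mono ?_⟩
      simp only [hP]
      rw [div_le_iff₀ (by positivity)]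
      have h1 : 1 ≤ ε * m := by
        rw [div_le_iff₀ hε] at hm
        linarith
      push_cast
      nlinarith [mul_nonneg hε.le (Nat.cast_nonneg (α := ℝ) (p.eval I₀.n))]

/-! ### The degenerate case and the choice of the block length -/

/-- The QCSP on qubits without clause types. -/
def trivialQCSP : QCSP 2 where
  numTypes := 0
  arity := Fin.elim0
  clause i := i.elim0
  clause_hermitian i := i.elim0
  clause_idempotent i := i.elim0

theorem trivialQCSP_satisfiable (I : trivialQCSP.Instance) : I.Satisfiable :=
  ⟨fun _ => 1, fun h => one_ne_zero (congrFun h fun _ => 0), fun c => c.type.elim0⟩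

/-- The instance without qudits and clauses. -/
def emptyInstance (C : QCSP d) : C.Instance := ⟨0, []⟩

theorem emptyInstance_encodes (C : QCSP d) : C.emptyInstance.Encodes [false, false] :=
  ⟨0, 0, by simp [Instance.ints, emptyInstance], by simp [Instance.ints, emptyInstance, bits]⟩

theorem emptyInstance_satisfiable (C : QCSP d) : C.emptyInstance.Satisfiable :=
  ⟨fun _ => 1, fun h => one_ne_zero (congrFun h Fin.elim0), fun _ hc =>
    (List.not_mem_nil hc).elim⟩

theorem isAC0_const_false_false : IsAC0 fun _ => [false, false] := by
  have := (AC0Rel.const fun _ : ℕ => False).isAC0 2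
  simpa using this

/-- A QCSP all of whose instances are satisfiable reduces to every QCSP. -/
theorem reducesVia_of_forall_satisfiable {d' : ℕ} (C : QCSP d) (C' : QCSP d')
    (h : ∀ I : C.Instance, I.Satisfiable) : C.ReducesVia C' fun _ => [false, false] := by
  have hyes : ∃ I : C'.Instance, I.Encodes [false, false] ∧ I.Satisfiable :=
    ⟨_, C'.emptyInstance_encodes, C'.emptyInstance_satisfiable⟩
  refine ⟨⟨fun _ _ => hyes, ?_⟩, fun b hb => ⟨b, hb, fun _ _ => hyes, ?_⟩⟩
  · rintro s ⟨I, -, hI⟩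
    exact absurd (h I) hI
  · rintro s ⟨I, -, hI⟩
    exact absurd hI ((h I).not_energyAtLeast (hb.pos I.n))

end QCSP

theorem theorem4 (d : ℕ) (hd : 2 ≤ d) (C : QCSP d) :
    ∃ C' : QCSP 2,
      (∃ f g : List Bool → List Bool,
        IsAC0 f ∧ IsAC0 g ∧ C.ReducesVia C' f ∧ C'.ReducesVia C g) ∧
      ∀ k : ℕ, C.IsLocal k →
        C'.IsLocal (4 * 2 ^ Nat.clog 2 (Nat.clog 2 d) * k) := by
  have : NeZero d := ⟨by omega⟩
  -- Conflicting instances need an unsatisfiable image; if C has none, a QCSP that is always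
  -- satisfiable is used instead.
  by_cases hC : ∀ I : C.Instance, I.Satisfiable
  · exact ⟨QCSP.trivialQCSP, ⟨_, _, QCSP.isAC0_const_false_false, QCSP.isAC0_const_false_false,
      C.reducesVia_of_forall_satisfiable _ hC,
      QCSP.reducesVia_of_forall_satisfiable _ C QCSP.trivialQCSP_satisfiable⟩,
      fun k _ i => i.elim0⟩
  · push Not at hC
    obtain ⟨I₀, hI₀⟩ := hC
    generalize hx : Nat.clog 2 (Nat.clog 2 d) = x
    have hr : 2 ^ (x + 2) = 4 * 2 ^ x := by ring
    -- With r = 4·2^x one has r − 2 ≥ 2^x ≥ ⌈log₂ d⌉, so d ≤ 2^(r−2).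
    have hd' : d ≤ 2 ^ (2 ^ (x + 2) - 2) := by
      refine (Nat.le_pow_clog one_lt_two d).trans (Nat.pow_le_pow_right (by omega) ?_)
      have h1 := Nat.le_pow_clog one_lt_two (Nat.clog 2 d)
      have h2 : 1 ≤ 2 ^ x := Nat.one_le_two_pow
      rw [hx] at h1
      omega
    have hd'' : 2 ^ (2 ^ (x + 2) - 2) ≤ 2 ^ 2 ^ (x + 2) :=
      Nat.pow_le_pow_right (by omega) (Nat.sub_le _ _)
    -- M = 2^r − d functionals leave a kernel of dimension at least d for the code, and d ≤ 2^(r−2)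
    -- makes them numerous enough to separate conflicting blocks.
    obtain ⟨B, hS⟩ := exists_separating (r := 2 ^ (x + 2)) (M := 2 ^ 2 ^ (x + 2) - d)
      (Nat.sub_le_sub_left hd' _)
    obtain ⟨V, hV, hB⟩ := exists_isometry_mul_eq_zero (d := d) B (by
      rw [Fintype.card_fun, Fintype.card_fin, Fintype.card_fin]
      omega)
    obtain ⟨g, hg, hgr⟩ := C.exists_decode_reducesVia hV hB hS hI₀
    refine ⟨C.encode V hV, ⟨_, g, QCSP.isAC0_encodeMap C (x + 2), hg, C.encode_reducesVia hV, hgr⟩,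
      fun k hk i => ?_⟩
    calc C.arity i * 2 ^ (x + 2) ≤ k * 2 ^ (x + 2) := Nat.mul_le_mul_right _ (hk i)
      _ = 4 * 2 ^ x * k := by ring
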